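/- **Conventions.** A hypercomplex manifold $(M,H)$ is a smooth $4n$-manifold with a triple $H=(J_1,J_2,J_3)$ of integrable almost complex structures with $J_s^2=-\mathrm{id}$ and $J_1J_2=-J_2J_1=J_3$. Its Obata connection $\nabla^{ob}$ is the unique torsion-free connection with $\nabla^{ob}J_s=0$, $s=1,2,3$. A Riemannian metric $g$ is hyperhermitian if $g(J_s\cdot,J_s\cdot)=g$ for $s=1,2,3$. Given a hyperhermitian metric $g$ (one always exists), let $R^{ob}(X,Y)Z=\nabla^{ob}_X\nabla^{ob}_YZ-\nabla^{ob}_Y\nabla^{ob}_XZ-\nabla^{ob}_{[X,Y]}Z$, $R^{ob}(X,Y,Z,U)=g(R^{ob}(X,Y)Z,U)$ and, for a $g$-orthonormal basis $e_1,\dots,e_{4n}$ of the tangent space, $$Ric^{ob}(X,Y)=\sum_{a}R^{ob}(e_a,X,Y,e_a),\quad \rho^{ob}(X,Y)=\sum_{a}R^{ob}(X,Y,e_a,e_a),\quad \rho^{ob}_s(X,Y)=\tfrac12\sum_{a}R^{ob}(X,Y,e_a,J_se_a),$$ $$Scal^{ob}=\sum_{a}Ric^{ob}(e_a,e_a),\qquad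 Scal^{ob}_s=\sum_{a}Ric^{ob}(J_se_a,e_a).$$ $(M,g,H,\nabla)$ is an HKT manifold if $(M,H)$ is hypercomplex, $g$ is hyperhermitian, and $\nabla$ is a linear connection with $\nabla g=0$, $\nabla J_s=0$ $(s=1,2,3)$ whose torsion $T(X,Y,Z)=g(\nabla_XY-\nabla_YX-[X,Y],Z)$ is totally skew-symmetric. Its Lee form is $\theta(X)=-\frac12\sum_{a}T(J_tX,e_a,J_te_a)$, where $t\in\{1,2,3\}$ is arbitrary. For a one-form, $d\theta(X,Y)=X\theta(Y)-Y\theta(X)-\theta([X,Y])$. **Proposition.** On a hypercomplex manifold $(M,H)$, for $s=1,2,3$ and all $X,Y$, $$Ric^{ob}(J_sX,J_sY)+Ric^{ob}(Y,X)=2\rho^{ob}_s(J_sX,Y),\qquad Ric^{ob}(X,Y)-Ric^{ob}(Y,X)=-\rho^{ob}(X,Y).$$ On an HKT manifold $(M,g,H,\nabla)$, with the traces above taken with respect to $g$: a) $d\theta(J_sX,J_sY)=d\theta(X,Y)$ for $s=1,2,3$; b) $Ric^{ob}$ is skew-symmetric, and $$Ric^{ob}(X,Y)=d\theta(X,Y),\qquad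 \rho^{ob}=-2\,d\theta,\qquad \rho^{ob}_s=0,\quad s=1,2,3;$$ in particular $Ric^{ob}(J_sX,J_sY)=Ric^{ob}(X,Y)$ for $s=1,2,3$; c) $Scal^{ob}=Scal^{ob}_s=0$, $s=1,2,3$. -/

import Mathlib

open Bundle VectorField
open scoped Manifold ContDiff

noncomputable section HypercomplexDefinitions

variable {n : ℕ} {M : Type*} [TopologicalSpace M]
  [ChartedSpace (EuclideanSpace ℝ (Fin (4 * n))) M] [IsManifold (𝓡 (4 * n)) ∞ M]

/-- The vector field `X` is smooth. -/
abbrev IsSmoothField (X : ∀ x : M, TangentSpace (𝓡 (4 * n)) x) : Prop :=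
  ContMDiff (𝓡 (4 * n)) (𝓡 (4 * n)).tangent ∞
    (fun y => (⟨y, X y⟩ : TangentBundle (𝓡 (4 * n)) M))

/-- The vector field `X` is differentiable at the point `x`. -/
abbrev IsDifferentiableFieldAt (X : ∀ x : M, TangentSpace (𝓡 (4 * n)) x) (x : M) : Prop :=
  MDifferentiableAt (𝓡 (4 * n)) (𝓡 (4 * n)).tangent
    (fun y => (⟨y, X y⟩ : TangentBundle (𝓡 (4 * n)) M)) x

/-- A hypercomplex structure on a `4n`-dimensional smooth manifold: a triple of smooth almost
complex structures `J 0, J 1, J 2` (written `J₁, J₂, J₃` on paper) satisfying the quaternionic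
identities, each of which is integrable, i.e. has vanishing Nijenhuis tensor
`N(X, Y) = [JX, JY] - J[JX, Y] - J[X, JY] - [X, Y]`. -/
structure HypercomplexStructure (n : ℕ) (M : Type*) [TopologicalSpace M]
    [ChartedSpace (EuclideanSpace ℝ (Fin (4 * n))) M] [IsManifold (𝓡 (4 * n)) ∞ M] where
  /-- The three almost complex structures. -/
  J : Fin 3 → ∀ x : M, TangentSpace (𝓡 (4 * n)) x →L[ℝ] TangentSpace (𝓡 (4 * n)) x
  smooth : ∀ s, ContMDiff (𝓡 (4 * n))
    ((𝓡 (4 * n)).prod 𝓘(ℝ, EuclideanSpace ℝ (Fin (4 * n)) →L[ℝ] EuclideanSpace ℝ (Fin (4 * n)))) ∞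
    (fun x => TotalSpace.mk' (EuclideanSpace ℝ (Fin (4 * n)) →L[ℝ] EuclideanSpace ℝ (Fin (4 * n)))
      (E := fun x : M => TangentSpace (𝓡 (4 * n)) x →L[ℝ] TangentSpace (𝓡 (4 * n)) x) x (J s x))
  sq : ∀ s x v, J s x (J s x v) = -v
  mul_01 : ∀ x v, J 0 x (J 1 x v) = J 2 x v
  mul_10 : ∀ x v, J 1 x (J 0 x v) = -J 2 x v
  integrable : ∀ s (X Y : ∀ x : M, TangentSpace (𝓡 (4 * n)) x),
    IsSmoothField X → IsSmoothField Y → ∀ x,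
      mlieBracket (𝓡 (4 * n)) (fun y => J s y (X y)) (fun y => J s y (Y y)) x
        - J s x (mlieBracket (𝓡 (4 * n)) (fun y => J s y (X y)) Y x)
        - J s x (mlieBracket (𝓡 (4 * n)) X (fun y => J s y (Y y)) x)
        - mlieBracket (𝓡 (4 * n)) X Y x = 0

/-- Smooth Riemannian metrics on `M`. -/
abbrev TangentMetric (n : ℕ) (M : Type*) [TopologicalSpace M]
    [ChartedSpace (EuclideanSpace ℝ (Fin (4 * n))) M] [IsManifold (𝓡 (4 * n)) ∞ M] :=
  ContMDiffRiemannianMetric (𝓡 (4 * n)) ∞ (EuclideanSpace ℝ (Fin (4 * n)))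
    (fun x : M => TangentSpace (𝓡 (4 * n)) x)

/-- Linear connections on `M`; `D Y x v` is `(∇_v Y)(x)`. -/
abbrev LinearConnection (n : ℕ) (M : Type*) [TopologicalSpace M]
    [ChartedSpace (EuclideanSpace ℝ (Fin (4 * n))) M] [IsManifold (𝓡 (4 * n)) ∞ M] :=
  CovariantDerivative (𝓡 (4 * n)) (EuclideanSpace ℝ (Fin (4 * n)))
    (fun x : M => TangentSpace (𝓡 (4 * n)) x)

/-- The metric `g` is hyperhermitian: `g(J_s X, J_s Y) = g(X, Y)` for `s = 1, 2, 3`. -/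
def IsHyperhermitian (H : HypercomplexStructure n M) (g : TangentMetric n M) : Prop :=
  ∀ s x v w, g.inner x (H.J s x v) (H.J s x w) = g.inner x v w

/-- `∇ J_s = 0` for `s = 1, 2, 3`, i.e. `∇_v (J_s Y) = J_s (∇_v Y)`. -/
def PreservesHypercomplex (H : HypercomplexStructure n M) (D : LinearConnection n M) : Prop :=
  ∀ s (Y : ∀ x : M, TangentSpace (𝓡 (4 * n)) x) (x : M), IsDifferentiableFieldAt Y x →
    ∀ v, D (fun y => H.J s y (Y y)) x v = H.J s x (D Y x v)

/-- `∇ g = 0`, i.e. `v(g(Y, Z)) = g(∇_v Y, Z) + g(Y, ∇_v Z)`. -/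
def PreservesMetric (g : TangentMetric n M) (D : LinearConnection n M) : Prop :=
  ∀ (Y Z : ∀ x : M, TangentSpace (𝓡 (4 * n)) x) (x : M), IsDifferentiableFieldAt Y x → IsDifferentiableFieldAt Z x →
    ∀ v, mvfderiv (𝓡 (4 * n)) (fun y => g.inner y (Y y) (Z y)) x v
      = g.inner x (D Y x v) (Z x) + g.inner x (Y x) (D Z x v)

/-- The Obata connection of a hypercomplex manifold: the (unique) smooth linear connection with
`∇ J₁ = ∇ J₂ = ∇ J₃ = 0` and vanishing torsion. -/
structure IsObataConnection (H : HypercomplexStructure n M) (D : LinearConnection n M) : Prop where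
  smooth : CovariantDerivative.ContMDiffCovariantDerivative D ∞
  preserves : PreservesHypercomplex H D
  torsion_eq_zero : ∀ x, D.torsion x = 0

/-- The torsion of type `(0,3)`: `T(X, Y, Z) = g(T(X, Y), Z)`, where
`T(X, Y) = ∇_X Y - ∇_Y X - [X, Y]`. -/
def torsionThree (g : TangentMetric n M) (D : LinearConnection n M) (x : M)
    (u v w : TangentSpace (𝓡 (4 * n)) x) : ℝ :=
  g.inner x (D.torsion x u v) w

/-- `(M, g, H, ∇)` is hyperkähler with torsion: the metric `g` is hyperhermitian and `∇` is a smooth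
linear connection preserving `g` and `J₁, J₂, J₃` whose torsion is totally skew-symmetric.
(Skew-symmetry of `T(X, Y, Z)` in the first two arguments is automatic.) -/
structure IsHKT (H : HypercomplexStructure n M) (g : TangentMetric n M)
    (D : LinearConnection n M) : Prop where
  hyperhermitian : IsHyperhermitian H g
  smooth : CovariantDerivative.ContMDiffCovariantDerivative D ∞
  preserves : PreservesHypercomplex H D
  preserves_metric : PreservesMetric g D
  skew_torsion : ∀ x u v w, torsionThree g D x u v w = -torsionThree g D x u w v

/-- A `g`-orthonormal basis `e_1, …, e_{4n}` of `T_x M`. Every sum over it below is the trace of a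
bilinear form with respect to `g`, hence does not depend on which orthonormal basis is used. -/
def orthoFrame (g : TangentMetric n M) (x : M) :
    Module.Basis (Fin (4 * n)) ℝ (TangentSpace (𝓡 (4 * n)) x) :=
  letI : RiemannianBundle (fun x : M => TangentSpace (𝓡 (4 * n)) x) := ⟨g.toRiemannianMetric⟩
  haveI : FiniteDimensional ℝ (TangentSpace (𝓡 (4 * n)) x) :=
    inferInstanceAs (FiniteDimensional ℝ (EuclideanSpace ℝ (Fin (4 * n))))
  ((stdOrthonormalBasis ℝ (TangentSpace (𝓡 (4 * n)) x)).reindex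
    (finCongr (finrank_euclideanSpace_fin (𝕜 := ℝ) (n := 4 * n)))).toBasis

/-- The basis `orthoFrame g x` is indeed orthonormal. -/
theorem orthoFrame_inner (g : TangentMetric n M) (x : M) (a b : Fin (4 * n)) :
    g.inner x (orthoFrame g x a) (orthoFrame g x b) = if a = b then 1 else 0 := by
  let _ : RiemannianBundle (fun x : M => TangentSpace (𝓡 (4 * n)) x) := ⟨g.toRiemannianMetric⟩
  have : FiniteDimensional ℝ (TangentSpace (𝓡 (4 * n)) x) :=
    inferInstanceAs (FiniteDimensional ℝ (EuclideanSpace ℝ (Fin (4 * n))))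
  have h := ((stdOrthonormalBasis ℝ (TangentSpace (𝓡 (4 * n)) x)).reindex
    (finCongr (finrank_euclideanSpace_fin (𝕜 := ℝ) (n := 4 * n)))).inner_eq_ite a b
  rw [← h]
  simp [orthoFrame]
  rfl

/-- The Lee form of an HKT manifold computed from the complex structure `J_t`:
`θ(X) = -1/2 ∑ₐ T(J_t X, e_a, J_t e_a)`, with `T` the torsion three-form of the HKT connection. -/
def leeForm (H : HypercomplexStructure n M) (g : TangentMetric n M) (D : LinearConnection n M)
    (t : Fin 3) (x : M) (v : TangentSpace (𝓡 (4 * n)) x) : ℝ :=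
  -(1 / 2) * ∑ a, torsionThree g D x (H.J t x v) (orthoFrame g x a) (H.J t x (orthoFrame g x a))

/-- The exterior derivative of a one-form, `dα(X, Y) = X(α(Y)) - Y(α(X)) - α([X, Y])`. The tangent
vectors `u, v` at `x` are extended to the vector fields that are constant in the preferred chart at
`x` (the result does not depend on the choice of the extensions). -/
def extDerivOneForm (α : ∀ x : M, TangentSpace (𝓡 (4 * n)) x → ℝ) (x : M)
    (u v : TangentSpace (𝓡 (4 * n)) x) : ℝ :=
  let X := FiberBundle.extend (EuclideanSpace ℝ (Fin (4 * n))) u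
  let Y := FiberBundle.extend (EuclideanSpace ℝ (Fin (4 * n))) v
  mvfderiv (𝓡 (4 * n)) (fun y => α y (Y y)) x u - mvfderiv (𝓡 (4 * n)) (fun y => α y (X y)) x v
    - α x (mlieBracket (𝓡 (4 * n)) X Y x)

/-- The curvature `R(X, Y)Z = ∇_X ∇_Y Z - ∇_Y ∇_X Z - ∇_{[X, Y]} Z` of a linear connection. The
tangent vectors `u, v, w` at `x` are extended to the vector fields that are constant in the
preferred chart at `x` (the result does not depend on the choice of the extensions). -/
def curvature (D : LinearConnection n M) (x : M) (u v w : TangentSpace (𝓡 (4 * n)) x) :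
    TangentSpace (𝓡 (4 * n)) x :=
  let X := FiberBundle.extend (EuclideanSpace ℝ (Fin (4 * n))) u
  let Y := FiberBundle.extend (EuclideanSpace ℝ (Fin (4 * n))) v
  let Z := FiberBundle.extend (EuclideanSpace ℝ (Fin (4 * n))) w
  D (fun y => D Z y (Y y)) x u - D (fun y => D Z y (X y)) x v
    - D Z x (mlieBracket (𝓡 (4 * n)) X Y x)

/-- The curvature tensor of type `(0,4)`: `R(X, Y, Z, U) = g(R(X, Y)Z, U)`. -/
def curvatureFour (g : TangentMetric n M) (D : LinearConnection n M) (x : M)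
    (u v w z : TangentSpace (𝓡 (4 * n)) x) : ℝ :=
  g.inner x (curvature D x u v w) z

/-- The Ricci tensor `Ric(X, Y) = ∑ₐ R(e_a, X, Y, e_a)`. -/
def ricciTensor (g : TangentMetric n M) (D : LinearConnection n M) (x : M)
    (u v : TangentSpace (𝓡 (4 * n)) x) : ℝ :=
  ∑ a, curvatureFour g D x (orthoFrame g x a) u v (orthoFrame g x a)

/-- The Ricci-type form `ρ(X, Y) = ∑ₐ R(X, Y, e_a, e_a)`. -/
def ricciForm (g : TangentMetric n M) (D : LinearConnection n M) (x : M)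
    (u v : TangentSpace (𝓡 (4 * n)) x) : ℝ :=
  ∑ a, curvatureFour g D x u v (orthoFrame g x a) (orthoFrame g x a)

/-- The Ricci-type form `ρ_s(X, Y) = 1/2 ∑ₐ R(X, Y, e_a, J_s e_a)`. -/
def ricciFormJ (H : HypercomplexStructure n M) (g : TangentMetric n M) (D : LinearConnection n M)
    (s : Fin 3) (x : M) (u v : TangentSpace (𝓡 (4 * n)) x) : ℝ :=
  (1 / 2) * ∑ a, curvatureFour g D x u v (orthoFrame g x a) (H.J s x (orthoFrame g x a))

/-- The scalar curvature `Scal = ∑ₐ Ric(e_a, e_a)`. -/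
def scalarCurvature (g : TangentMetric n M) (D : LinearConnection n M) (x : M) : ℝ :=
  ∑ a, ricciTensor g D x (orthoFrame g x a) (orthoFrame g x a)

/-- The scalar curvature `Scal_s = ∑ₐ Ric(J_s e_a, e_a)`. -/
def scalarCurvatureJ (H : HypercomplexStructure n M) (g : TangentMetric n M)
    (D : LinearConnection n M) (s : Fin 3) (x : M) : ℝ :=
  ∑ a, ricciTensor g D x (H.J s x (orthoFrame g x a)) (orthoFrame g x a)

end HypercomplexDefinitions

/-!
The curvature `R` of the Obata connection commutes with the complex structures `J_s` and satisfies
the algebraic Bianchi identity; both identities on a hypercomplex manifold are consequences of these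
two facts. Some `J_t` anticommutes with `J_s`, and conjugation by it shows that every endomorphism
commuting with the three structures is trace-free against `J_s`. Hence `ρ_s = 0` and
`Ric(J_s X, J_s Y) = -Ric(Y, X)`, and since `J₃ = J₁ J₂`, applying this identity for `J₁` and `J₂`
in succession and comparing with `J₃` gives the skew-symmetry of `Ric`. Therefore `ρ = -2 Ric`.

The form `ρ(X, Y)` is the trace of `R(X, Y)`. The traces of the curvatures of two connections on a
vector bundle differ by the exterior derivative of the trace of the difference of the connections.
The HKT connection is metric, so the trace of its curvature vanishes, and since its torsion is
skew-symmetric, the trace of its difference with the Obata connection is `-2 θ`. This gives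
`ρ = -2 dθ`.
-/

open scoped Topology

section OrthonormalBasis

variable {R V ι : Type*} [CommRing R] [AddCommGroup V] [Module R V] [Fintype ι] [DecidableEq ι]
  {g : LinearMap.BilinForm R V} {b : Module.Basis ι R V}

theorem sum_bilinForm_apply_orthonormal (hb : LinearMap.BilinForm.toMatrix b g = 1)
    (A : Module.End R V) : ∑ i, g (A (b i)) (b i) = LinearMap.trace R V A := by
  have h : LinearMap.BilinForm.toMatrix b (g.compLeft A)
      = (LinearMap.toMatrix b b A).transpose := by
    rw [LinearMap.BilinForm.toMatrix_compLeft, hb, mul_one]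
  rw [LinearMap.trace_eq_matrix_trace R b, ← Matrix.trace_transpose, ← h]
  simp [Matrix.trace]

theorem sum_bilinForm_isometry (hb : LinearMap.BilinForm.toMatrix b g = 1) {J : Module.End R V}
    (hJ : g.comp J J = g) (B : LinearMap.BilinForm R V) :
    ∑ i, B (J (b i)) (J (b i)) = ∑ i, B (b i) (b i) := by
  have hJJ : (LinearMap.toMatrix b b J).transpose * LinearMap.toMatrix b b J = 1 := by
    simpa only [LinearMap.BilinForm.toMatrix_comp b b, hb, mul_one] using
      congr(LinearMap.BilinForm.toMatrix b $hJ)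
  calc ∑ i, B (J (b i)) (J (b i))
      = (LinearMap.BilinForm.toMatrix b (B.comp J J)).trace := by simp [Matrix.trace]
    _ = (LinearMap.BilinForm.toMatrix b B).trace := by
      rw [LinearMap.BilinForm.toMatrix_comp b b, Matrix.trace_mul_comm, ← mul_assoc,
        mul_eq_one_comm.1 hJJ, one_mul]
    _ = ∑ i, B (b i) (b i) := by simp [Matrix.trace]

/- The isometry `J` conjugates `K` into `-K`, so the trace is equal to its own opposite. -/
theorem sum_bilinForm_anticommuting_eq_zero [NoZeroDivisors R] [CharZero R]
    (hb : LinearMap.BilinForm.toMatrix b g = 1) {J K : Module.End R V} (hJ : g.comp J J = g)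
    (hJK : J * K = -(K * J)) {B : LinearMap.BilinForm R V} (hB : B.comp J J = B) :
    ∑ i, B (b i) (K (b i)) = 0 := by
  have hK : ∀ v, K (J v) = -J (K v) := fun v => by
    simpa [eq_neg_iff_add_eq_zero, add_comm] using congr($hJK v)
  have hconj : ∑ i, B (b i) (K (b i)) = -∑ i, B (b i) (K (b i)) := by
    calc ∑ i, B (b i) (K (b i))
        = ∑ i, B (J (b i)) (K (J (b i))) := (sum_bilinForm_isometry hb hJ (B.compRight K)).symm
      _ = -∑ i, B.comp J J (b i) (K (b i)) := by simp [hK]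
      _ = -∑ i, B (b i) (K (b i)) := by rw [hB]
  exact CharZero.eq_neg_self_iff.1 hconj

end OrthonormalBasis

section SmoothNear

variable {E H M : Type*} [NormedAddCommGroup E] [NormedSpace ℝ E] [TopologicalSpace H]
  {I : ModelWithCorners ℝ E H} [TopologicalSpace M] [ChartedSpace H M]
  {E' H' M' : Type*} [NormedAddCommGroup E'] [NormedSpace ℝ E'] [TopologicalSpace H']
  {I' : ModelWithCorners ℝ E' H'} [TopologicalSpace M'] [ChartedSpace H' M']
  {f f' : M → M'} {x : M}

/-- The map `f` is smooth in a neighbourhood of `x`. This is stronger than `ContMDiffAt I I' ∞ f x`,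
which provides a neighbourhood for each finite order of differentiability only. -/
def SmoothNear (I : ModelWithCorners ℝ E H) (I' : ModelWithCorners ℝ E' H') (f : M → M') (x : M) :
    Prop :=
  ∀ᶠ y in 𝓝 x, ContMDiffAt I I' ∞ f y

theorem SmoothNear.eventually (hf : SmoothNear I I' f x) : ∀ᶠ y in 𝓝 x, SmoothNear I I' f y :=
  eventually_eventually_nhds.2 hf

theorem SmoothNear.contMDiffAt (hf : SmoothNear I I' f x) : ContMDiffAt I I' ∞ f x :=
  hf.self_of_nhds

theorem SmoothNear.mdifferentiableAt (hf : SmoothNear I I' f x) : MDifferentiableAt I I' f x :=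
  hf.contMDiffAt.mdifferentiableAt (by simp)

theorem SmoothNear.congr (hf : SmoothNear I I' f x) (h : f' =ᶠ[𝓝 x] f) : SmoothNear I I' f' x := by
  filter_upwards [hf, h.eventuallyEq_nhds] with y hy hy'
  exact hy.congr_of_eventuallyEq hy'

theorem SmoothNear.exists_contMDiffOn (hf : SmoothNear I I' f x) :
    ∃ s, IsOpen s ∧ x ∈ s ∧ ContMDiffOn I I' ∞ f s := by
  obtain ⟨s, hs, hso, hxs⟩ := eventually_nhds_iff.1 hf
  exact ⟨s, hso, hxs, fun y hy => (hs y hy).contMDiffWithinAt⟩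

end SmoothNear

section SmoothSections

variable {E H M : Type*} [NormedAddCommGroup E] [NormedSpace ℝ E] [TopologicalSpace H]
  {I : ModelWithCorners ℝ E H} [TopologicalSpace M] [ChartedSpace H M]
  {F : Type*} [NormedAddCommGroup F] [NormedSpace ℝ F] {V : M → Type*}
  [TopologicalSpace (TotalSpace F V)] [∀ x, TopologicalSpace (V x)] [FiberBundle F V]

/-- The section `σ` of the bundle `V` is smooth in a neighbourhood of `x`. -/
abbrev SmoothSectionNear (I : ModelWithCorners ℝ E H) (F : Type*) [NormedAddCommGroup F]
    [NormedSpace ℝ F] {V : M → Type*} [TopologicalSpace (TotalSpace F V)]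
    [∀ x, TopologicalSpace (V x)] [FiberBundle F V] (σ : ∀ x, V x) (x : M) : Prop :=
  SmoothNear I (I.prod 𝓘(ℝ, F)) (fun y => TotalSpace.mk' F y (σ y)) x

variable {σ τ : ∀ x, V x} {x : M} {f : M → ℝ}

theorem SmoothSectionNear.congr (hσ : SmoothSectionNear I F σ x) (h : ∀ᶠ y in 𝓝 x, τ y = σ y) :
    SmoothSectionNear I F τ x :=
  SmoothNear.congr hσ (h.mono fun y hy => congrArg (TotalSpace.mk' F y) hy)

variable [∀ x, AddCommGroup (V x)] [∀ x, Module ℝ (V x)] [VectorBundle ℝ F V]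

theorem SmoothSectionNear.add (hσ : SmoothSectionNear I F σ x) (hτ : SmoothSectionNear I F τ x) :
    SmoothSectionNear I F (σ + τ) x := by
  filter_upwards [hσ, hτ] with y h1 h2 using h1.add_section h2

theorem SmoothSectionNear.neg (hσ : SmoothSectionNear I F σ x) : SmoothSectionNear I F (-σ) x := by
  filter_upwards [hσ] with y h using h.neg_section

theorem SmoothSectionNear.smul (hf : SmoothNear I 𝓘(ℝ, ℝ) f x) (hσ : SmoothSectionNear I F σ x) :
    SmoothSectionNear I F (f • σ) x := by
  filter_upwards [hf, hσ] with y h1 h2 using h1.smul_section h2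

theorem SmoothSectionNear.sum {ι : Type*} {s : Finset ι} {σ : ι → ∀ x, V x}
    (hσ : ∀ i ∈ s, SmoothSectionNear I F (σ i) x) :
    SmoothSectionNear I F (fun y => ∑ i ∈ s, σ i y) x := by
  filter_upwards [(Filter.eventually_all_finset s).2 hσ] with y h using ContMDiffAt.sum_section h

theorem smoothSectionNear_extend [ContMDiffVectorBundle ∞ F V I] (v : V x) :
    SmoothSectionNear I F (FiberBundle.extend F v) x := by
  obtain ⟨s, hs, hsv⟩ := FiberBundle.exists_contMDiffOn_extend (k := ∞) I F v
  filter_upwards [eventually_mem_nhds_iff.2 hs] with y hy using hsv.contMDiffAt hy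

theorem SmoothSectionNear.inner (g : ContMDiffRiemannianMetric I ∞ F V)
    (hσ : SmoothSectionNear I F σ x) (hτ : SmoothSectionNear I F τ x) :
    SmoothNear I 𝓘(ℝ, ℝ) (fun y => g.inner y (σ y) (τ y)) x := by
  filter_upwards [hσ, hτ] with y h1 h2
  have h : ContMDiffAt I (I.prod 𝓘(ℝ, ℝ)) ∞
      (fun z => TotalSpace.mk' ℝ (E := Bundle.Trivial M ℝ) z (g.inner z (σ z) (τ z))) y :=
    g.contMDiff.contMDiffAt.clm_bundle_apply₂ h1 h2
  exact (contMDiffAt_totalSpace.1 h).2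

theorem SmoothSectionNear.exists_contMDiff [FiniteDimensional ℝ E] [T2Space M] [IsManifold I ∞ M]
    (hσ : SmoothSectionNear I F σ x) :
    ∃ τ : ∀ x, V x, ContMDiff I (I.prod 𝓘(ℝ, F)) ∞ (fun y => TotalSpace.mk' F y (τ y)) ∧
      ∀ᶠ y in 𝓝 x, τ y = σ y := by
  obtain ⟨s, hso, hxs, hs⟩ := SmoothNear.exists_contMDiffOn hσ
  obtain ⟨ψ, -, hψ⟩ :=
    (SmoothBumpFunction.nhds_basis_tsupport (I := I) x).mem_iff.1 (hso.mem_nhds hxs)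
  refine ⟨⇑ψ • σ, ContMDiffOn.smul_section_of_tsupport ψ.contMDiff.contMDiffOn hso hψ hs, ?_⟩
  filter_upwards [ψ.eventuallyEq_one] with y hy
  simp [hy]

variable {F' : Type*} [NormedAddCommGroup F'] [NormedSpace ℝ F'] {V' : M → Type*}
  [TopologicalSpace (TotalSpace F' V')] [∀ x, AddCommGroup (V' x)] [∀ x, Module ℝ (V' x)]
  [∀ x, TopologicalSpace (V' x)] [∀ x, IsTopologicalAddGroup (V' x)]
  [∀ x, ContinuousSMul ℝ (V' x)] [FiberBundle F' V'] [VectorBundle ℝ F' V']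

theorem SmoothSectionNear.clm_apply {A : ∀ x, V x →L[ℝ] V' x}
    (hA : SmoothSectionNear I (F →L[ℝ] F') A x) (hσ : SmoothSectionNear I F σ x) :
    SmoothSectionNear I F' (fun y => A y (σ y)) x := by
  filter_upwards [hA, hσ] with y h1 h2 using h1.clm_bundle_apply h2

end SmoothSections

section DirectionalDerivative

variable {E H M : Type*} [NormedAddCommGroup E] [NormedSpace ℝ E] [TopologicalSpace H]
  {I : ModelWithCorners ℝ E H} [TopologicalSpace M] [ChartedSpace H M]
  {X Y Z : ∀ x : M, TangentSpace I x} {f h : M → ℝ} {x : M}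

/-- The derivative of the function `f` along the vector field `X`. -/
noncomputable def dirDeriv (X : ∀ x : M, TangentSpace I x) (f : M → ℝ) (x : M) : ℝ :=
  mvfderiv I f x (X x)

theorem mvfderiv_congr (hfh : f =ᶠ[𝓝 x] h) : mvfderiv I f x = mvfderiv I h x := by
  simp only [mvfderiv, hfh.mfderiv_eq]
  rfl

theorem SmoothNear.sum {ι : Type*} {s : Finset ι} {f : ι → M → ℝ}
    (hf : ∀ i ∈ s, SmoothNear I 𝓘(ℝ, ℝ) (f i) x) :
    SmoothNear I 𝓘(ℝ, ℝ) (fun y => ∑ i ∈ s, f i y) x := by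
  filter_upwards [(Filter.eventually_all_finset s).2 hf] with y h using ContMDiffAt.sum h

theorem mvfderiv_fun_sum {ι : Type*} {s : Finset ι} {f : ι → M → ℝ}
    (hf : ∀ i ∈ s, SmoothNear I 𝓘(ℝ, ℝ) (f i) x) :
    mvfderiv I (fun y => ∑ i ∈ s, f i y) x = ∑ i ∈ s, mvfderiv I (f i) x := by
  classical
  induction s using Finset.induction_on with
  | empty => simp [mvfderiv_const]
  | insert a s ha ih =>
    simp only [Finset.mem_insert, forall_eq_or_imp] at hf
    simp only [Finset.sum_insert ha]
    rw [mvfderiv_fun_add hf.1.mdifferentiableAt (SmoothNear.sum hf.2).mdifferentiableAt, ih hf.2]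

theorem SmoothNear.dirDeriv [IsManifold I ∞ M] (hf : SmoothNear I 𝓘(ℝ, ℝ) f x)
    (hX : SmoothSectionNear I E X x) : SmoothNear I 𝓘(ℝ, ℝ) (dirDeriv X f) x := by
  obtain ⟨s, hso, hxs, hs⟩ := hf.exists_contMDiffOn
  filter_upwards [hX, hso.mem_nhds hxs] with y hy hys
  have hdf := (hs.contMDiffOn_tangentMapWithin (m := ∞) (by simp) hso.uniqueMDiffOn).contMDiffAt
    (x := ⟨y, X y⟩) ((hso.preimage (FiberBundle.continuous_proj E _)).mem_nhds hys)
  have hcomp := (contMDiff_snd_tangentBundle_modelSpace ℝ 𝓘(ℝ, ℝ)).contMDiffAt.comp y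
    (hdf.comp y hy)
  refine hcomp.congr_of_eventuallyEq ?_
  filter_upwards [hso.mem_nhds hys] with z hz
  change mfderiv I 𝓘(ℝ, ℝ) f z (X z) = mfderivWithin I 𝓘(ℝ, ℝ) f s z (X z)
  rw [mfderivWithin_of_isOpen hso hz]

theorem SmoothSectionNear.mlieBracket [CompleteSpace E] [IsManifold I ∞ M]
    (hX : SmoothSectionNear I E X x) (hY : SmoothSectionNear I E Y x) :
    SmoothSectionNear I E (mlieBracket I X Y) x := by
  filter_upwards [hX, hY] with y h1 h2
  have : IsManifold I ((⊤ : ℕ∞) + 1) M := by simpa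
  have : IsManifold I (minSmoothness ℝ 2) M := by
    rw [minSmoothness_of_isRCLikeNormedField]
    infer_instance
  exact ContMDiffAt.mlieBracket_vectorField (n := ⊤) (m := ⊤) h1 h2 (by simp)

theorem mlieBracket_jacobi [CompleteSpace E] [IsManifold I ∞ M] (hX : SmoothSectionNear I E X x)
    (hY : SmoothSectionNear I E Y x) (hZ : SmoothSectionNear I E Z x) :
    mlieBracket I X (mlieBracket I Y Z) x
      = mlieBracket I (mlieBracket I X Y) Z x + mlieBracket I Y (mlieBracket I X Z) x := by
  have : IsManifold I (minSmoothness ℝ 3) M := by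
    rw [minSmoothness_of_isRCLikeNormedField]
    infer_instance
  have h2 : minSmoothness ℝ 2 ≤ ∞ := by
    rw [minSmoothness_of_isRCLikeNormedField]
    exact ENat.LEInfty.out
  exact leibniz_identity_mlieBracket_apply (hX.contMDiffAt.of_le h2) (hY.contMDiffAt.of_le h2)
    (hZ.contMDiffAt.of_le h2)

theorem mlieBracket_mlieBracket_smul [CompleteSpace E] [IsManifold I ∞ M]
    (hY : SmoothSectionNear I E Y x) (hZ : SmoothSectionNear I E Z x)
    (hf : SmoothNear I 𝓘(ℝ, ℝ) f x) :
    mlieBracket I X (mlieBracket I Y (f • Z)) x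
      = dirDeriv X (dirDeriv Y f) x • Z x + dirDeriv Y f x • mlieBracket I X Z x
        + (dirDeriv X f x • mlieBracket I Y Z x
          + f x • mlieBracket I X (mlieBracket I Y Z) x) := by
  have hfYZ := SmoothSectionNear.smul hf (hY.mlieBracket hZ)
  have hYfZ := SmoothSectionNear.smul (hf.dirDeriv hY) hZ
  have h : mlieBracket I Y (f • Z) =ᶠ[𝓝 x] dirDeriv Y f • Z + f • mlieBracket I Y Z := by
    filter_upwards [hf.eventually, hZ.eventually] with y hf hZ
    exact mlieBracket_smul_right hf.mdifferentiableAt hZ.mdifferentiableAt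
  rw [Filter.EventuallyEq.rfl.mlieBracket_vectorField_eq h,
    mlieBracket_add_right hYfZ.mdifferentiableAt hfYZ.mdifferentiableAt,
    mlieBracket_smul_right (hf.dirDeriv hY).mdifferentiableAt hZ.mdifferentiableAt,
    mlieBracket_smul_right hf.mdifferentiableAt (hY.mlieBracket hZ).mdifferentiableAt]
  rfl

/- Apply the Jacobi identity to `X`, `Y` and `f • Z`, where `Z` does not vanish at `x`. -/
theorem dirDeriv_mlieBracket [CompleteSpace E] [IsManifold I ∞ M] (hX : SmoothSectionNear I E X x)
    (hY : SmoothSectionNear I E Y x) (hf : SmoothNear I 𝓘(ℝ, ℝ) f x) :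
    dirDeriv (mlieBracket I X Y) f x
      = dirDeriv X (dirDeriv Y f) x - dirDeriv Y (dirDeriv X f) x := by
  cases subsingleton_or_nontrivial (TangentSpace I x) with
  | inl _ => simp [dirDeriv, Subsingleton.elim _ (0 : TangentSpace I x)]
  | inr _ =>
    obtain ⟨v, hv⟩ := exists_ne (0 : TangentSpace I x)
    have hZ : SmoothSectionNear I E (FiberBundle.extend E v) x := smoothSectionNear_extend v
    have hZf : mlieBracket I (mlieBracket I X Y) (f • FiberBundle.extend E v) x = _ :=
      mlieBracket_smul_right hf.mdifferentiableAt hZ.mdifferentiableAt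
    have h := mlieBracket_jacobi hX hY (hZ.smul hf)
    rw [mlieBracket_mlieBracket_smul hY hZ hf, mlieBracket_mlieBracket_smul hX hZ hf, hZf,
      mlieBracket_jacobi hX hY hZ, FiberBundle.extend_apply_self] at h
    have h' : (dirDeriv (mlieBracket I X Y) f x
        - (dirDeriv X (dirDeriv Y f) x - dirDeriv Y (dirDeriv X f) x)) • v = 0 := by
      simp only [dirDeriv] at h ⊢
      linear_combination (norm := module) -h
    exact sub_eq_zero.1 ((smul_eq_zero.1 h').resolve_right hv)

end DirectionalDerivative

section LocalFrames

variable {E H M : Type*} [NormedAddCommGroup E] [NormedSpace ℝ E] [TopologicalSpace H]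
  {I : ModelWithCorners ℝ E H} [TopologicalSpace M] [ChartedSpace H M]
  {F : Type*} [NormedAddCommGroup F] [NormedSpace ℝ F] [FiniteDimensional ℝ F] {V : M → Type*}
  [TopologicalSpace (TotalSpace F V)] [∀ x, AddCommGroup (V x)] [∀ x, Module ℝ (V x)]
  [∀ x, TopologicalSpace (V x)] [FiberBundle F V] [VectorBundle ℝ F V]

/-- The local frame of the bundle `V` around `x` that corresponds to `Module.finBasis ℝ F` in the
preferred trivialization at `x`. -/
noncomputable def frameAt (F : Type*) [NormedAddCommGroup F] [NormedSpace ℝ F]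
    [FiniteDimensional ℝ F] {V : M → Type*} [TopologicalSpace (TotalSpace F V)]
    [∀ x, AddCommGroup (V x)] [∀ x, Module ℝ (V x)] [∀ x, TopologicalSpace (V x)]
    [FiberBundle F V] [VectorBundle ℝ F V] (x : M) (i : Fin (Module.finrank ℝ F)) (y : M) : V y :=
  (trivializationAt F V x).localFrame (Module.finBasis ℝ F) i y

theorem smoothSectionNear_frameAt [ContMDiffVectorBundle ∞ F V I] (x : M)
    (i : Fin (Module.finrank ℝ F)) : SmoothSectionNear I F (V := V) (frameAt F x i) x := by
  filter_upwards [(trivializationAt F V x).open_baseSet.mem_nhds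
    (FiberBundle.mem_baseSet_trivializationAt F V x)] with y hy
  exact contMDiffAt_localFrame_of_mem ∞ _ _ i hy

/-- The coefficients of the elements of `V` with respect to `frameAt F x`. -/
noncomputable def frameCoeffAt (I : ModelWithCorners ℝ E H) (F : Type*) [NormedAddCommGroup F]
    [NormedSpace ℝ F] [FiniteDimensional ℝ F] {V : M → Type*} [TopologicalSpace (TotalSpace F V)]
    [∀ x, AddCommGroup (V x)] [∀ x, Module ℝ (V x)] [∀ x, TopologicalSpace (V x)]
    [FiberBundle F V] [VectorBundle ℝ F V] [ContMDiffVectorBundle 1 F V I] (x : M)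
    (i : Fin (Module.finrank ℝ F)) (y : M) : V y →ₗ[ℝ] ℝ :=
  (trivializationAt F V x).localFrameCoeff I (Module.finBasis ℝ F) i y

theorem SmoothSectionNear.frameCoeffAt [ContMDiffVectorBundle ∞ F V I] {σ : ∀ x, V x} {x : M}
    (hσ : SmoothSectionNear I F σ x) (i : Fin (Module.finrank ℝ F)) :
    SmoothNear I 𝓘(ℝ, ℝ) (fun y => frameCoeffAt I F x i y (σ y)) x := by
  filter_upwards [hσ, (trivializationAt F V x).open_baseSet.mem_nhds
    (FiberBundle.mem_baseSet_trivializationAt F V x)] with y h hy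
  exact contMDiffAt_localFrameCoeff _ hy h i

variable [ContMDiffVectorBundle 1 F V I]

theorem eventually_exists_basis_frameAt (x : M) : ∀ᶠ y in 𝓝 x,
    ∃ b : Module.Basis (Fin (Module.finrank ℝ F)) ℝ (V y),
      (∀ i, b i = frameAt F x i y) ∧ ∀ i v, b.repr v i = frameCoeffAt I F x i y v := by
  filter_upwards [(trivializationAt F V x).open_baseSet.mem_nhds
    (FiberBundle.mem_baseSet_trivializationAt F V x)] with y hy
  refine ⟨Trivialization.basisAt _ (Module.finBasis ℝ F) hy,
    fun i => (Trivialization.localFrame_apply_of_mem_baseSet _ _ hy).symm, fun i v => ?_⟩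
  have h := Trivialization.localFrameCoeff_apply_of_mem_baseSet (I := I) (V := V) _
    (Module.finBasis ℝ F) hy (FiberBundle.extend F v) i
  simp only [FiberBundle.extend_apply_self] at h
  exact h.symm

theorem eventually_eq_sum_frameAt (x : M) : ∀ᶠ y in 𝓝 x, ∀ v : V y,
    v = ∑ i, frameCoeffAt I F x i y v • frameAt F x i y := by
  filter_upwards [eventually_exists_basis_frameAt (I := I) (F := F) (V := V) x]
    with y ⟨b, hb, hcoeff⟩ v
  simp [← hb, ← hcoeff, b.sum_repr]

theorem eventually_trace_eq_sum_frameAt (x : M) : ∀ᶠ y in 𝓝 x, ∀ A : V y →ₗ[ℝ] V y,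
    LinearMap.trace ℝ (V y) A = ∑ i, frameCoeffAt I F x i y (A (frameAt F x i y)) := by
  filter_upwards [eventually_exists_basis_frameAt (I := I) (F := F) (V := V) x]
    with y ⟨b, hb, hcoeff⟩ A
  simp [LinearMap.trace_eq_matrix_trace ℝ b, Matrix.trace, LinearMap.toMatrix_apply, hb, hcoeff]

theorem frameCoeffAt_frameAt (x : M) (i j : Fin (Module.finrank ℝ F)) :
    frameCoeffAt I F (V := V) x i x (frameAt F x j x) = if j = i then 1 else 0 := by
  obtain ⟨b, hb, hcoeff⟩ :=
    (eventually_exists_basis_frameAt (I := I) (F := F) (V := V) x).self_of_nhds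
  rw [← hb, ← hcoeff, b.repr_self, Finsupp.single_apply]

end LocalFrames

section Connections

variable {E H M : Type*} [NormedAddCommGroup E] [NormedSpace ℝ E] [TopologicalSpace H]
  {I : ModelWithCorners ℝ E H} [TopologicalSpace M] [ChartedSpace H M]
  {F : Type*} [NormedAddCommGroup F] [NormedSpace ℝ F] {V : M → Type*}
  [TopologicalSpace (TotalSpace F V)] [∀ x, AddCommGroup (V x)] [∀ x, Module ℝ (V x)]
  [∀ x, TopologicalSpace (V x)] [∀ x, IsTopologicalAddGroup (V x)] [∀ x, ContinuousSMul ℝ (V x)]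
  [FiberBundle F V] {σ τ : ∀ x, V x} {f : M → ℝ} {x : M} {X : ∀ x : M, TangentSpace I x}

theorem connection_congr (D : CovariantDerivative I F V) (hσ : SmoothSectionNear I F σ x)
    (h : ∀ᶠ y in 𝓝 x, τ y = σ y) : D τ x = D σ x :=
  (D.isCovariantDerivativeOn (s := Set.univ)).congr_of_eventuallyEq
    (hσ.congr h).mdifferentiableAt hσ.mdifferentiableAt Filter.univ_mem h

theorem connection_add (D : CovariantDerivative I F V) (hσ : SmoothSectionNear I F σ x)
    (hτ : SmoothSectionNear I F τ x) (v : TangentSpace I x) :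
    D (σ + τ) x v = D σ x v + D τ x v :=
  congr($((D.isCovariantDerivativeOn (s := Set.univ)).add
    hσ.mdifferentiableAt hτ.mdifferentiableAt) v)

theorem connection_smul (D : CovariantDerivative I F V) (hf : SmoothNear I 𝓘(ℝ, ℝ) f x)
    (hσ : SmoothSectionNear I F σ x) (v : TangentSpace I x) :
    D (f • σ) x v = f x • D σ x v + mvfderiv I f x v • σ x :=
  congr($((D.isCovariantDerivativeOn (s := Set.univ)).leibniz
    hσ.mdifferentiableAt hf.mdifferentiableAt) v)

theorem connection_neg (D : CovariantDerivative I F V) (hσ : SmoothSectionNear I F σ x)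
    (v : TangentSpace I x) : D (-σ) x v = -D σ x v := by
  have h := (D.isCovariantDerivativeOn (s := Set.univ)).smul_const (-1) hσ.mdifferentiableAt
  rw [neg_one_smul, neg_one_smul] at h
  exact congr($h v)

variable [VectorBundle ℝ F V]

theorem connection_sub (D : CovariantDerivative I F V) (hσ : SmoothSectionNear I F σ x)
    (hτ : SmoothSectionNear I F τ x) (v : TangentSpace I x) :
    D (σ - τ) x v = D σ x v - D τ x v := by
  rw [sub_eq_add_neg, connection_add D hσ hτ.neg, connection_neg D hτ, sub_eq_add_neg]

theorem connection_sum (D : CovariantDerivative I F V) {ι : Type*} {s : Finset ι}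
    {σ : ι → ∀ x, V x} (hσ : ∀ i ∈ s, SmoothSectionNear I F (σ i) x) (v : TangentSpace I x) :
    D (fun y => ∑ i ∈ s, σ i y) x v = ∑ i ∈ s, D (σ i) x v := by
  classical
  induction s using Finset.induction_on with
  | empty =>
    simp only [Finset.sum_empty]
    exact congr($(D.isCovariantDerivativeOnUniv.zero (x := x)) v)
  | insert a s ha ih =>
    simp only [Finset.mem_insert, forall_eq_or_imp] at hσ
    simp only [Finset.sum_insert ha]
    rw [← ih hσ.2]
    exact connection_add D hσ.1 (.sum hσ.2) v

theorem SmoothSectionNear.connection [FiniteDimensional ℝ E] [T2Space M] [IsManifold I ∞ M]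
    (D : CovariantDerivative I F V) [D.ContMDiffCovariantDerivative ∞]
    (hσ : SmoothSectionNear I F σ x) (hX : SmoothSectionNear I E X x) :
    SmoothSectionNear I F (fun y => D σ y (X y)) x := by
  obtain ⟨τ, hτ, hτσ⟩ := hσ.exists_contMDiff
  have hDτ : SmoothSectionNear I (E →L[ℝ] F) (D τ) x := .of_forall fun y =>
    (CovariantDerivative.ContMDiffCovariantDerivative.contMDiff.contMDiff (σ := τ)
      hτ.contMDiffOn).contMDiffAt Filter.univ_mem
  refine (hDτ.clm_apply hX).congr ?_
  filter_upwards [hσ.eventually, eventually_eventually_nhds.2 hτσ] with y hσy hτy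
  rw [connection_congr D hσy hτy]

theorem frameCoeffAt_connection [FiniteDimensional ℝ F] [ContMDiffVectorBundle ∞ F V I]
    (D : CovariantDerivative I F V) (hσ : SmoothSectionNear I F σ x)
    (i : Fin (Module.finrank ℝ F)) (v : TangentSpace I x) :
    frameCoeffAt I F x i x (D σ x v)
      = mvfderiv I (fun y => frameCoeffAt I F x i y (σ y)) x v
        + ∑ j, frameCoeffAt I F x j x (σ x) * frameCoeffAt I F x i x (D (frameAt F x j) x v) := by
  have hsummand : ∀ j, SmoothSectionNear I F
      ((fun y => frameCoeffAt I F x j y (σ y)) • frameAt F (V := V) x j) x := fun j =>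
    SmoothSectionNear.smul (hσ.frameCoeffAt j) (smoothSectionNear_frameAt x j)
  have hexpand : D σ x v
      = ∑ j, D ((fun y => frameCoeffAt I F x j y (σ y)) • frameAt F x j) x v := by
    rw [← connection_sum D (fun j _ => hsummand j),
      connection_congr D (SmoothSectionNear.sum fun j _ => hsummand j)]
    filter_upwards [eventually_eq_sum_frameAt (I := I) (F := F) (V := V) x] with y hy using hy (σ y)
  rw [hexpand, map_sum, add_comm]
  simp only [connection_smul D (hσ.frameCoeffAt _) (smoothSectionNear_frameAt x _), map_add,
    map_smul, smul_eq_mul, Finset.sum_add_distrib, frameCoeffAt_frameAt]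
  simp

end Connections

section Curvature

variable {E H M : Type*} [NormedAddCommGroup E] [NormedSpace ℝ E] [TopologicalSpace H]
  {I : ModelWithCorners ℝ E H} [TopologicalSpace M] [ChartedSpace H M]
  {F : Type*} [NormedAddCommGroup F] [NormedSpace ℝ F] {V : M → Type*}
  [TopologicalSpace (TotalSpace F V)] [∀ x, AddCommGroup (V x)] [∀ x, Module ℝ (V x)]
  [∀ x, TopologicalSpace (V x)] [∀ x, IsTopologicalAddGroup (V x)] [∀ x, ContinuousSMul ℝ (V x)]
  [FiberBundle F V] {σ τ : ∀ x, V x} {f : M → ℝ} {x : M} {X Y : ∀ x : M, TangentSpace I x}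

/-- The curvature `R(X, Y)σ = ∇_X ∇_Y σ - ∇_Y ∇_X σ - ∇_{[X, Y]} σ` of the connection `D`, for
vector fields `X`, `Y` and a section `σ`. -/
noncomputable def curvatureField (D : CovariantDerivative I F V) (X Y : ∀ x : M, TangentSpace I x)
    (σ : ∀ x, V x) (x : M) : V x :=
  D (fun y => D σ y (Y y)) x (X x) - D (fun y => D σ y (X y)) x (Y x)
    - D σ x (mlieBracket I X Y x)

theorem curvatureField_swap (D : CovariantDerivative I F V) (X Y : ∀ x : M, TangentSpace I x)
    (σ : ∀ x, V x) (x : M) : curvatureField D X Y σ x = -curvatureField D Y X σ x := by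
  simp only [curvatureField]
  rw [mlieBracket_swap_apply, map_neg]
  abel

/-- The field `A` of endomorphisms of the bundle `V` is parallel: `∇_v (Aσ) = A (∇_v σ)`. -/
def IsParallelEndomorphism (D : CovariantDerivative I F V) (A : ∀ x, V x →L[ℝ] V x) : Prop :=
  ∀ (σ : ∀ x, V x) (x : M),
    MDifferentiableAt I (I.prod 𝓘(ℝ, F)) (fun y => TotalSpace.mk' F y (σ y)) x →
    ∀ v, D (fun y => A y (σ y)) x v = A x (D σ x v)

variable [VectorBundle ℝ F V]

/-- The connection `D` is compatible with the metric `g`, that is `∇g = 0`. -/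
def IsMetricConnection (g : ContMDiffRiemannianMetric I ∞ F V) (D : CovariantDerivative I F V) :
    Prop :=
  ∀ (σ τ : ∀ x, V x) (x : M),
    MDifferentiableAt I (I.prod 𝓘(ℝ, F)) (fun y => TotalSpace.mk' F y (σ y)) x →
    MDifferentiableAt I (I.prod 𝓘(ℝ, F)) (fun y => TotalSpace.mk' F y (τ y)) x →
    ∀ v, mvfderiv I (fun y => g.inner y (σ y) (τ y)) x v
      = g.inner x (D σ x v) (τ x) + g.inner x (σ x) (D τ x v)

theorem IsMetricConnection.dirDeriv_inner_self {D : CovariantDerivative I F V}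
    {g : ContMDiffRiemannianMetric I ∞ F V} (hg : IsMetricConnection g D)
    (hσ : SmoothSectionNear I F σ x) (X : ∀ x : M, TangentSpace I x) :
    dirDeriv X (fun y => g.inner y (σ y) (σ y)) x = 2 * g.inner x (D σ x (X x)) (σ x) := by
  rw [dirDeriv, hg σ σ x hσ.mdifferentiableAt hσ.mdifferentiableAt, g.symm x (σ x), two_mul]

variable [FiniteDimensional ℝ E] [T2Space M] [IsManifold I ∞ M]
  (D : CovariantDerivative I F V) [D.ContMDiffCovariantDerivative ∞]

theorem connection_connection_congr (hσ : SmoothSectionNear I F σ x)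
    (hX : SmoothSectionNear I E X x) (h : ∀ᶠ y in 𝓝 x, τ y = σ y) (v : TangentSpace I x) :
    D (fun y => D τ y (X y)) x v = D (fun y => D σ y (X y)) x v := by
  rw [connection_congr D (hσ.connection D hX)]
  filter_upwards [eventually_eventually_nhds.2 h, hσ.eventually] with y hτ hσy
  rw [connection_congr D hσy hτ]

theorem connection_connection_add (hσ : SmoothSectionNear I F σ x)
    (hτ : SmoothSectionNear I F τ x) (hX : SmoothSectionNear I E X x) (v : TangentSpace I x) :
    D (fun y => D (σ + τ) y (X y)) x v
      = D (fun y => D σ y (X y)) x v + D (fun y => D τ y (X y)) x v := by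
  rw [← connection_add D (hσ.connection D hX) (hτ.connection D hX),
    connection_congr D ((hσ.connection D hX).add (hτ.connection D hX))]
  filter_upwards [hσ.eventually, hτ.eventually] with y hσy hτy using connection_add D hσy hτy _

theorem connection_connection_smul (hf : SmoothNear I 𝓘(ℝ, ℝ) f x)
    (hσ : SmoothSectionNear I F σ x) (hX : SmoothSectionNear I E X x) (v : TangentSpace I x) :
    D (fun y => D (f • σ) y (X y)) x v
      = f x • D (fun y => D σ y (X y)) x v + mvfderiv I f x v • D σ x (X x)
        + (dirDeriv X f x • D σ x v + mvfderiv I (dirDeriv X f) x v • σ x) := by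
  have hfDσ := SmoothSectionNear.smul hf (hσ.connection D hX)
  have hXfσ := SmoothSectionNear.smul (hf.dirDeriv hX) hσ
  rw [connection_congr D (hfDσ.add hXfσ), connection_add D hfDσ hXfσ,
    connection_smul D hf (hσ.connection D hX), connection_smul D (hf.dirDeriv hX) hσ]
  filter_upwards [hf.eventually, hσ.eventually] with y hfy hσy using connection_smul D hfy hσy _

section Tensoriality

variable (hX : SmoothSectionNear I E X x) (hY : SmoothSectionNear I E Y x)
include hX hY

theorem curvatureField_congr (hσ : SmoothSectionNear I F σ x) (h : ∀ᶠ y in 𝓝 x, τ y = σ y) :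
    curvatureField D X Y τ x = curvatureField D X Y σ x := by
  simp only [curvatureField]
  rw [connection_connection_congr D hσ hX h, connection_connection_congr D hσ hY h,
    connection_congr D hσ h]

theorem curvatureField_add (hσ : SmoothSectionNear I F σ x) (hτ : SmoothSectionNear I F τ x) :
    curvatureField D X Y (σ + τ) x = curvatureField D X Y σ x + curvatureField D X Y τ x := by
  simp only [curvatureField]
  rw [connection_connection_add D hσ hτ hX, connection_connection_add D hσ hτ hY,
    connection_add D hσ hτ]
  abel

theorem curvatureField_smul (hf : SmoothNear I 𝓘(ℝ, ℝ) f x) (hσ : SmoothSectionNear I F σ x) :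
    curvatureField D X Y (f • σ) x = f x • curvatureField D X Y σ x := by
  have hbracket := dirDeriv_mlieBracket hX hY hf
  simp only [dirDeriv] at hbracket
  simp only [curvatureField]
  rw [connection_connection_smul D hf hσ hX, connection_connection_smul D hf hσ hY,
    connection_smul D hf hσ, hbracket]
  simp only [dirDeriv]
  module

theorem curvatureField_sum {ι : Type*} {s : Finset ι} {σ : ι → ∀ x, V x}
    (hσ : ∀ i ∈ s, SmoothSectionNear I F (σ i) x) :
    curvatureField D X Y (fun y => ∑ i ∈ s, σ i y) x = ∑ i ∈ s, curvatureField D X Y (σ i) x := by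
  classical
  induction s using Finset.induction_on with
  | empty =>
    have hzero : SmoothSectionNear I F (0 : ∀ x, V x) x := .sum (s := ∅) (σ := σ) (by simp)
    have h := curvatureField_add D hX hY hzero hzero
    rw [add_zero, right_eq_add] at h
    simpa only [Finset.sum_empty] using! h
  | insert a s ha ih =>
    simp only [Finset.mem_insert, forall_eq_or_imp] at hσ
    simp only [Finset.sum_insert ha]
    rw [← ih hσ.2]
    exact curvatureField_add D hX hY hσ.1 (.sum hσ.2)

variable [FiniteDimensional ℝ F] [ContMDiffVectorBundle ∞ F V I]

theorem curvatureField_eq_sum_frameAt (hσ : SmoothSectionNear I F σ x) :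
    curvatureField D X Y σ x
      = ∑ i, frameCoeffAt I F x i x (σ x) • curvatureField D X Y (frameAt F x i) x := by
  have hsummand : ∀ i, SmoothSectionNear I F
      ((fun y => frameCoeffAt I F x i y (σ y)) • frameAt F (V := V) x i) x := fun i =>
    SmoothSectionNear.smul (hσ.frameCoeffAt i) (smoothSectionNear_frameAt x i)
  rw [← curvatureField_congr D hX hY hσ (τ := fun y => ∑ i,
    ((fun y => frameCoeffAt I F x i y (σ y)) • frameAt F (V := V) x i) y),
    curvatureField_sum D hX hY fun i _ => hsummand i]
  · exact Finset.sum_congr rfl fun i _ =>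
      curvatureField_smul D hX hY (hσ.frameCoeffAt i) (smoothSectionNear_frameAt x i)
  · filter_upwards [eventually_eq_sum_frameAt (I := I) (F := F) (V := V) x] with y hy
    exact (hy (σ y)).symm

theorem curvatureField_congr_point (hσ : SmoothSectionNear I F σ x)
    (hτ : SmoothSectionNear I F τ x) (h : σ x = τ x) :
    curvatureField D X Y σ x = curvatureField D X Y τ x := by
  rw [curvatureField_eq_sum_frameAt D hX hY hσ, curvatureField_eq_sum_frameAt D hX hY hτ, h]

end Tensoriality

variable {D}

theorem IsParallelEndomorphism.connection_connection {A : ∀ x, V x →L[ℝ] V x}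
    (hDA : IsParallelEndomorphism D A) (hA : SmoothSectionNear I (F →L[ℝ] F) A x)
    (hσ : SmoothSectionNear I F σ x) (hX : SmoothSectionNear I E X x) (v : TangentSpace I x) :
    D (fun y => D (fun z => A z (σ z)) y (X y)) x v = A x (D (fun y => D σ y (X y)) x v) := by
  rw [← hDA _ x (hσ.connection D hX).mdifferentiableAt,
    connection_congr D (hA.clm_apply (hσ.connection D hX))]
  filter_upwards [hσ.eventually] with y hy using hDA σ y hy.mdifferentiableAt _

theorem IsParallelEndomorphism.curvatureField {A : ∀ x, V x →L[ℝ] V x}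
    (hDA : IsParallelEndomorphism D A) (hA : SmoothSectionNear I (F →L[ℝ] F) A x)
    (hX : SmoothSectionNear I E X x) (hY : SmoothSectionNear I E Y x)
    (hσ : SmoothSectionNear I F σ x) :
    curvatureField D X Y (fun y => A y (σ y)) x = A x (curvatureField D X Y σ x) := by
  simp only [_root_.curvatureField]
  rw [hDA.connection_connection hA hσ hX, hDA.connection_connection hA hσ hY,
    hDA σ x hσ.mdifferentiableAt, map_sub, map_sub]

variable {g : ContMDiffRiemannianMetric I ∞ F V}

theorem IsMetricConnection.dirDeriv_dirDeriv_inner_self (hg : IsMetricConnection g D)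
    (hσ : SmoothSectionNear I F σ x) (X : ∀ x : M, TangentSpace I x)
    (hY : SmoothSectionNear I E Y x) :
    dirDeriv X (dirDeriv Y (fun y => g.inner y (σ y) (σ y))) x
      = 2 * (g.inner x (D (fun y => D σ y (Y y)) x (X x)) (σ x)
        + g.inner x (D σ x (Y x)) (D σ x (X x))) := by
  have hDσ := hσ.connection D hY
  have hinner := (hDσ.inner g hσ).mdifferentiableAt
  have hfirst : dirDeriv Y (fun y => g.inner y (σ y) (σ y)) =ᶠ[𝓝 x]
      fun y => g.inner y (D σ y (Y y)) (σ y) + g.inner y (D σ y (Y y)) (σ y) := by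
    filter_upwards [hσ.eventually] with y hy
    rw [hg.dirDeriv_inner_self hy, two_mul]
  rw [dirDeriv, mvfderiv_congr hfirst, mvfderiv_fun_add hinner hinner, add_apply,
    hg _ σ x hDσ.mdifferentiableAt hσ.mdifferentiableAt, two_mul]

/- The commutator of two derivatives of `g(σ, σ)` is the derivative along the bracket. -/
theorem IsMetricConnection.inner_curvatureField_self (hg : IsMetricConnection g D)
    (hX : SmoothSectionNear I E X x) (hY : SmoothSectionNear I E Y x)
    (hσ : SmoothSectionNear I F σ x) : g.inner x (curvatureField D X Y σ x) (σ x) = 0 := by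
  have hbracket := dirDeriv_mlieBracket hX hY (hσ.inner g hσ)
  rw [hg.dirDeriv_dirDeriv_inner_self hσ X hY, hg.dirDeriv_dirDeriv_inner_self hσ Y hX,
    hg.dirDeriv_inner_self hσ, g.symm x (D σ x (X x))] at hbracket
  simp only [curvatureField, map_sub, sub_apply]
  linarith

end Curvature

section CurvatureEndomorphism

variable {E H M : Type*} [NormedAddCommGroup E] [NormedSpace ℝ E] [FiniteDimensional ℝ E]
  [TopologicalSpace H] {I : ModelWithCorners ℝ E H} [TopologicalSpace M] [T2Space M]
  [ChartedSpace H M] [IsManifold I ∞ M]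
  {F : Type*} [NormedAddCommGroup F] [NormedSpace ℝ F] [FiniteDimensional ℝ F] {V : M → Type*}
  [TopologicalSpace (TotalSpace F V)] [∀ x, AddCommGroup (V x)] [∀ x, Module ℝ (V x)]
  [∀ x, TopologicalSpace (V x)] [∀ x, IsTopologicalAddGroup (V x)] [∀ x, ContinuousSMul ℝ (V x)]
  [FiberBundle F V] [VectorBundle ℝ F V] [ContMDiffVectorBundle ∞ F V I]
  (D : CovariantDerivative I F V) [D.ContMDiffCovariantDerivative ∞] {x : M}

/-- The curvature endomorphism `R(u, v)` of the fibre at `x`, for tangent vectors `u` and `v`. All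
vectors are extended to a neighbourhood by means of the preferred trivializations at `x`. -/
noncomputable def curvatureEnd (x : M) (u v : TangentSpace I x) : V x →ₗ[ℝ] V x where
  toFun w := curvatureField D (FiberBundle.extend E u) (FiberBundle.extend E v)
    (FiberBundle.extend F w) x
  map_add' w w' := by
    have hw := smoothSectionNear_extend (I := I) (F := F) w
    have hw' := smoothSectionNear_extend (I := I) (F := F) w'
    have hu := smoothSectionNear_extend (I := I) (F := E) u
    have hv := smoothSectionNear_extend (I := I) (F := E) v
    rw [← curvatureField_add D hu hv hw hw']
    exact curvatureField_congr_point D hu hv (smoothSectionNear_extend _) (hw.add hw') (by simp)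
  map_smul' c w := by
    have hw := smoothSectionNear_extend (I := I) (F := F) w
    have hu := smoothSectionNear_extend (I := I) (F := E) u
    have hv := smoothSectionNear_extend (I := I) (F := E) v
    have hc : SmoothNear I 𝓘(ℝ, ℝ) (fun _ => c) x := .of_forall fun _ => contMDiffAt_const
    rw [RingHom.id_apply, ← curvatureField_smul D hu hv hc hw]
    exact curvatureField_congr_point D hu hv (smoothSectionNear_extend _)
      (SmoothSectionNear.smul hc hw) (by simp)

theorem curvatureField_extend {σ : ∀ x, V x} (hσ : SmoothSectionNear I F σ x)
    (u v : TangentSpace I x) :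
    curvatureField D (FiberBundle.extend E u) (FiberBundle.extend E v) σ x
      = curvatureEnd D x u v (σ x) :=
  curvatureField_congr_point D (smoothSectionNear_extend u) (smoothSectionNear_extend v) hσ
    (smoothSectionNear_extend _) (FiberBundle.extend_apply_self _ _).symm

theorem curvatureEnd_swap (u v : TangentSpace I x) (w : V x) :
    curvatureEnd D x u v w = -curvatureEnd D x v u w :=
  curvatureField_swap D _ _ _ x

variable {D} in
theorem IsParallelEndomorphism.curvatureEnd_apply {A : ∀ x, V x →L[ℝ] V x}
    (hDA : IsParallelEndomorphism D A) (hA : SmoothSectionNear I (F →L[ℝ] F) A x)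
    (u v : TangentSpace I x) (w : V x) :
    curvatureEnd D x u v (A x w) = A x (curvatureEnd D x u v w) := by
  have hw := smoothSectionNear_extend (I := I) (F := F) w
  have h := hDA.curvatureField hA (smoothSectionNear_extend u) (smoothSectionNear_extend v) hw
  rwa [curvatureField_extend D (hA.clm_apply hw), FiberBundle.extend_apply_self] at h

variable {D} in
theorem IsMetricConnection.inner_curvatureEnd_self {g : ContMDiffRiemannianMetric I ∞ F V}
    (hg : IsMetricConnection g D) (u v : TangentSpace I x) (w : V x) :
    g.inner x (curvatureEnd D x u v w) w = 0 := by
  have h := hg.inner_curvatureField_self (smoothSectionNear_extend u) (smoothSectionNear_extend v)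
    (smoothSectionNear_extend (F := F) w)
  rwa [FiberBundle.extend_apply_self] at h

end CurvatureEndomorphism

section TraceOfCurvature

variable {E H M : Type*} [NormedAddCommGroup E] [NormedSpace ℝ E]
  [TopologicalSpace H] {I : ModelWithCorners ℝ E H} [TopologicalSpace M]
  [ChartedSpace H M]
  {F : Type*} [NormedAddCommGroup F] [NormedSpace ℝ F] [FiniteDimensional ℝ F] {V : M → Type*}
  [TopologicalSpace (TotalSpace F V)] [∀ x, AddCommGroup (V x)] [∀ x, Module ℝ (V x)]
  [∀ x, TopologicalSpace (V x)] [∀ x, IsTopologicalAddGroup (V x)] [∀ x, ContinuousSMul ℝ (V x)]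
  [FiberBundle F V] [VectorBundle ℝ F V]
  (D D' : CovariantDerivative I F V) {x : M}

/-- The trace of the connection form of `D` in the frame `frameAt F x`, applied to `X`. -/
noncomputable def connectionTrace [ContMDiffVectorBundle 1 F V I] (D : CovariantDerivative I F V)
    (x : M) (X : ∀ x : M, TangentSpace I x) (y : M) : ℝ :=
  ∑ i, frameCoeffAt I F x i y (D (frameAt F x i) y (X y))

variable [ContMDiffVectorBundle ∞ F V I] {X Y : ∀ x : M, TangentSpace I x}

/-- The endomorphism `w ↦ ∇'_v w - ∇_v w` of the fibre at `x`, for a tangent vector `v`. -/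
noncomputable def differenceEnd (x : M) (v : TangentSpace I x) : V x →ₗ[ℝ] V x where
  toFun w := D'.difference D x w v
  map_add' := by simp
  map_smul' := by simp

theorem differenceEnd_apply_section {σ : ∀ x, V x} (hσ : SmoothSectionNear I F σ x)
    (v : TangentSpace I x) :
    differenceEnd D D' x v (σ x) = D' σ x v - D σ x v :=
  congr($(IsCovariantDerivativeOn.difference_apply D'.isCovariantDerivativeOnUniv
    D.isCovariantDerivativeOnUniv (Set.mem_univ x) hσ.mdifferentiableAt) v)

theorem IsParallelEndomorphism.differenceEnd_apply {D D' : CovariantDerivative I F V}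
    {A : ∀ x, V x →L[ℝ] V x} (hA : SmoothSectionNear I (F →L[ℝ] F) A x)
    (hDA : IsParallelEndomorphism D A) (hDA' : IsParallelEndomorphism D' A)
    (v : TangentSpace I x) (w : V x) :
    differenceEnd D D' x v (A x w) = A x (differenceEnd D D' x v w) := by
  have hw := smoothSectionNear_extend (I := I) (F := F) w
  have h := differenceEnd_apply_section D D' (hA.clm_apply hw) v
  rw [hDA _ x hw.mdifferentiableAt, hDA' _ x hw.mdifferentiableAt, ← map_sub,
    ← differenceEnd_apply_section D D' hw] at h
  simpa only [FiberBundle.extend_apply_self] using h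

theorem eventually_connectionTrace_sub (x : M) (X : ∀ x : M, TangentSpace I x) :
    ∀ᶠ y in 𝓝 x, connectionTrace D' x X y - connectionTrace D x X y
      = LinearMap.trace ℝ (V y) (differenceEnd D D' y (X y)) := by
  have hframe := Filter.eventually_all.2 fun i =>
    (smoothSectionNear_frameAt (I := I) (F := F) (V := V) x i).eventually
  filter_upwards [eventually_trace_eq_sum_frameAt (I := I) (F := F) (V := V) x, hframe]
    with y htrace hframe
  rw [htrace, connectionTrace, connectionTrace, ← Finset.sum_sub_distrib]
  exact Finset.sum_congr rfl fun i _ => by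
    rw [differenceEnd_apply_section D D' (hframe i), map_sub]

variable [FiniteDimensional ℝ E] [IsManifold I ∞ M] [T2Space M]
  [D.ContMDiffCovariantDerivative ∞] [D'.ContMDiffCovariantDerivative ∞]

theorem smoothNear_connectionTrace (hX : SmoothSectionNear I E X x) :
    SmoothNear I 𝓘(ℝ, ℝ) (connectionTrace D x X) x :=
  SmoothNear.sum fun i _ => ((smoothSectionNear_frameAt x i).connection D hX).frameCoeffAt i

theorem sum_frameCoeffAt_connection_connection (hX : SmoothSectionNear I E X x)
    (v : TangentSpace I x) :
    ∑ i, frameCoeffAt I F x i x (D (fun y => D (frameAt F x i) y (X y)) x v)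
      = mvfderiv I (connectionTrace D x X) x v
        + ∑ i, ∑ j, frameCoeffAt I F x j x (D (frameAt F x i) x (X x))
          * frameCoeffAt I F x i x (D (frameAt F x j) x v) := by
  have hDframe := fun i => (smoothSectionNear_frameAt (V := V) x i).connection D hX
  have htrace : mvfderiv I (connectionTrace D x X) x = _ :=
    mvfderiv_fun_sum fun i _ => (hDframe i).frameCoeffAt i
  simp only [frameCoeffAt_connection D (hDframe _), Finset.sum_add_distrib, htrace, sum_apply]

/- The quadratic terms in the connection form have trace zero, by symmetry. -/
theorem sum_frameCoeffAt_curvatureField (hX : SmoothSectionNear I E X x)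
    (hY : SmoothSectionNear I E Y x) :
    ∑ i, frameCoeffAt I F x i x (curvatureField D X Y (frameAt F x i) x)
      = dirDeriv X (connectionTrace D x Y) x - dirDeriv Y (connectionTrace D x X) x
        - connectionTrace D x (mlieBracket I X Y) x := by
  simp only [curvatureField, map_sub, Finset.sum_sub_distrib,
    sum_frameCoeffAt_connection_connection D hX, sum_frameCoeffAt_connection_connection D hY]
  rw [Finset.sum_comm (f := fun i j => frameCoeffAt I F x j x (D (frameAt F x i) x (Y x)) * _)]
  simp only [dirDeriv, connectionTrace, mul_comm]
  ring

theorem trace_curvatureEnd (u v : TangentSpace I x) :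
    LinearMap.trace ℝ (V x) (curvatureEnd D x u v)
      = mvfderiv I (connectionTrace D x (FiberBundle.extend E v)) x u
        - mvfderiv I (connectionTrace D x (FiberBundle.extend E u)) x v
        - connectionTrace D x
            (mlieBracket I (FiberBundle.extend E u) (FiberBundle.extend E v)) x := by
  have h := sum_frameCoeffAt_curvatureField D (smoothSectionNear_extend u)
    (smoothSectionNear_extend v)
  simp only [dirDeriv, FiberBundle.extend_apply_self] at h
  rw [(eventually_trace_eq_sum_frameAt (I := I) (F := F) x).self_of_nhds, ← h]
  exact Finset.sum_congr rfl fun i _ => by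
    rw [curvatureField_extend D (smoothSectionNear_frameAt x i)]

theorem mvfderiv_connectionTrace_sub (hX : SmoothSectionNear I E X x) :
    mvfderiv I (connectionTrace D' x X) x - mvfderiv I (connectionTrace D x X) x
      = mvfderiv I (fun y => LinearMap.trace ℝ (V y) (differenceEnd D D' y (X y))) x := by
  rw [← mvfderiv_congr (eventually_connectionTrace_sub D D' x X)]
  exact (mvfderiv_fun_sub (smoothNear_connectionTrace D' hX).mdifferentiableAt
    (smoothNear_connectionTrace D hX).mdifferentiableAt).symm

theorem smoothNear_trace_differenceEnd (hX : SmoothSectionNear I E X x) :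
    SmoothNear I 𝓘(ℝ, ℝ) (fun y => LinearMap.trace ℝ (V y) (differenceEnd D D' y (X y))) x := by
  have hsub : SmoothNear I 𝓘(ℝ, ℝ)
      (fun y => connectionTrace D' x X y - connectionTrace D x X y) x := by
    filter_upwards [smoothNear_connectionTrace D' hX, smoothNear_connectionTrace D hX]
      with y hD' hD using hD'.sub hD
  exact hsub.congr <| (eventually_connectionTrace_sub D D' x X).mono fun _ => Eq.symm

theorem trace_curvatureEnd_sub (u v : TangentSpace I x) :
    LinearMap.trace ℝ (V x) (curvatureEnd D' x u v) - LinearMap.trace ℝ (V x) (curvatureEnd D x u v)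
      = mvfderiv I (fun y => LinearMap.trace ℝ (V y)
            (differenceEnd D D' y (FiberBundle.extend E v y))) x u
        - mvfderiv I (fun y => LinearMap.trace ℝ (V y)
            (differenceEnd D D' y (FiberBundle.extend E u y))) x v
        - LinearMap.trace ℝ (V x) (differenceEnd D D' x
            (mlieBracket I (FiberBundle.extend E u) (FiberBundle.extend E v) x)) := by
  rw [trace_curvatureEnd, trace_curvatureEnd,
    ← mvfderiv_connectionTrace_sub D D' (smoothSectionNear_extend u),
    ← mvfderiv_connectionTrace_sub D D' (smoothSectionNear_extend v),
    ← (eventually_connectionTrace_sub D D' x _).self_of_nhds]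
  simp only [sub_apply]
  ring

end TraceOfCurvature

section Torsion

variable {E H M : Type*} [NormedAddCommGroup E] [NormedSpace ℝ E] [FiniteDimensional ℝ E]
  [TopologicalSpace H] {I : ModelWithCorners ℝ E H} [TopologicalSpace M] [ChartedSpace H M]
  [IsManifold I ∞ M] {D D' : CovariantDerivative I E (TangentSpace I : M → Type _)} {x : M}
  {X Y : ∀ x : M, TangentSpace I x}

theorem connection_sub_swap_of_torsion_eq_zero (hT : ∀ x, D.torsion x = 0)
    (hX : SmoothSectionNear I E X x) (hY : SmoothSectionNear I E Y x) :
    D Y x (X x) - D X x (Y x) = mlieBracket I X Y x := by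
  have h := D.torsion_apply hX.mdifferentiableAt hY.mdifferentiableAt
  rw [hT] at h
  exact sub_eq_zero.1 h.symm

theorem connection_connection_sub_swap_of_torsion_eq_zero [T2Space M]
    [D.ContMDiffCovariantDerivative ∞] (hT : ∀ x, D.torsion x = 0)
    (hX : SmoothSectionNear I E X x) (hY : SmoothSectionNear I E Y x) (v : TangentSpace I x) :
    D (fun y => D Y y (X y)) x v - D (fun y => D X y (Y y)) x v = D (mlieBracket I X Y) x v := by
  rw [← connection_sub D (hY.connection D hX) (hX.connection D hY),
    ← connection_congr D (hX.mlieBracket hY)]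
  filter_upwards [hX.eventually, hY.eventually] with y hX hY
  exact connection_sub_swap_of_torsion_eq_zero hT hX hY

/- Torsion-freeness turns the cyclic sum of the curvature into that of `[X, [Y, Z]]`. -/
theorem curvatureEnd_bianchi [T2Space M] [D.ContMDiffCovariantDerivative ∞]
    (hT : ∀ x, D.torsion x = 0) (u v w : TangentSpace I x) :
    curvatureEnd D x u v w + curvatureEnd D x v w u + curvatureEnd D x w u v = 0 := by
  have hX := smoothSectionNear_extend (I := I) (F := E) u
  have hY := smoothSectionNear_extend (I := I) (F := E) v
  have hZ := smoothSectionNear_extend (I := I) (F := E) w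
  change curvatureField D _ _ _ x + curvatureField D _ _ _ x + curvatureField D _ _ _ x = 0
  set X : ∀ x : M, TangentSpace I x := FiberBundle.extend E u
  set Y : ∀ x : M, TangentSpace I x := FiberBundle.extend E v
  set Z : ∀ x : M, TangentSpace I x := FiberBundle.extend E w
  have hYZ := connection_connection_sub_swap_of_torsion_eq_zero hT hY hZ (X x)
  have hZX := connection_connection_sub_swap_of_torsion_eq_zero hT hZ hX (Y x)
  have hXY := connection_connection_sub_swap_of_torsion_eq_zero hT hX hY (Z x)
  have hX_YZ := connection_sub_swap_of_torsion_eq_zero hT hX (hY.mlieBracket hZ)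
  have hY_ZX := connection_sub_swap_of_torsion_eq_zero hT hY (hZ.mlieBracket hX)
  have hZ_XY := connection_sub_swap_of_torsion_eq_zero hT hZ (hX.mlieBracket hY)
  have hneg : mlieBracket I Y (mlieBracket I X Z) x
      = -mlieBracket I Y (mlieBracket I Z X) x := by
    rw [mlieBracket_swap (V := X)]
    simpa using mlieBracket_const_smul_right (I := I) (V := Y) (c := (-1 : ℝ))
      (hZ.mlieBracket hX).mdifferentiableAt
  have hjacobi := mlieBracket_jacobi hX hY hZ
  rw [mlieBracket_swap_apply (V := mlieBracket I X Y), hneg] at hjacobi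
  simp only [curvatureField]
  linear_combination (norm := module) hYZ + hZX + hXY + hX_YZ + hY_ZX + hZ_XY + hjacobi

theorem torsion_eq_differenceEnd_sub (hT : ∀ x, D'.torsion x = 0) (u v : TangentSpace I x) :
    D.torsion x u v = differenceEnd D D' x v u - differenceEnd D D' x u v := by
  have hX := smoothSectionNear_extend (I := I) (F := E) u
  have hY := smoothSectionNear_extend (I := I) (F := E) v
  have htorsion := D.torsion_apply hX.mdifferentiableAt hY.mdifferentiableAt
  have hbracket := connection_sub_swap_of_torsion_eq_zero hT hX hY
  have hu := differenceEnd_apply_section D D' hX v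
  have hv := differenceEnd_apply_section D D' hY u
  simp only [FiberBundle.extend_apply_self] at htorsion hbracket hu hv
  rw [htorsion, hu, hv]
  linear_combination (norm := module) hbracket

end Torsion

section HyperhermitianTraces

variable {n : ℕ} {M : Type*} [TopologicalSpace M]
  [ChartedSpace (EuclideanSpace ℝ (Fin (4 * n))) M] [IsManifold (𝓡 (4 * n)) ∞ M]
  {H : HypercomplexStructure n M} {g : TangentMetric n M} {x : M}

theorem HypercomplexStructure.exists_anticommute (H : HypercomplexStructure n M) (s : Fin 3) :
    ∃ t, ∀ x v, H.J t x (H.J s x v) = -H.J s x (H.J t x v) := by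
  have h10 : ∀ x v, H.J 1 x (H.J 0 x v) = -H.J 0 x (H.J 1 x v) := fun x v => by
    rw [H.mul_10, H.mul_01]
  fin_cases s
  · exact ⟨1, h10⟩
  · exact ⟨0, fun x v => (neg_eq_iff_eq_neg.2 (h10 x v)).symm⟩
  · refine ⟨0, fun x v => ?_⟩
    simp only [Fin.reduceFinMk, ← H.mul_01, h10]
    rw [map_neg, neg_neg]

theorem HypercomplexStructure.smoothSectionNear (H : HypercomplexStructure n M) (s : Fin 3)
    (x : M) : SmoothSectionNear (𝓡 (4 * n))
      (EuclideanSpace ℝ (Fin (4 * n)) →L[ℝ] EuclideanSpace ℝ (Fin (4 * n))) (H.J s) x :=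
  .of_forall fun _ => (H.smooth s).contMDiffAt

theorem IsHyperhermitian.inner_left (hg : IsHyperhermitian H g) (s : Fin 3)
    (v w : TangentSpace (𝓡 (4 * n)) x) : g.inner x (H.J s x v) w = -g.inner x v (H.J s x w) := by
  rw [← hg s x v (H.J s x w), H.sq, map_neg, neg_neg]

theorem toMatrix_orthoFrame_inner (g : TangentMetric n M) (x : M) :
    LinearMap.BilinForm.toMatrix (orthoFrame g x) (g.inner x).toBilinForm = 1 := by
  ext a b
  rw [LinearMap.BilinForm.toMatrix_apply, Matrix.one_apply]
  exact orthoFrame_inner g x a b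

theorem sum_inner_orthoFrame_eq_trace (g : TangentMetric n M)
    (A : Module.End ℝ (TangentSpace (𝓡 (4 * n)) x)) :
    ∑ a, g.inner x (A (orthoFrame g x a)) (orthoFrame g x a) = LinearMap.trace ℝ _ A :=
  sum_bilinForm_apply_orthonormal (toMatrix_orthoFrame_inner g x) A

theorem IsHyperhermitian.sum_bilinForm_complexStructure_eq_zero (hg : IsHyperhermitian H g)
    {B : LinearMap.BilinForm ℝ (TangentSpace (𝓡 (4 * n)) x)}
    (hB : ∀ t v w, B (H.J t x v) (H.J t x w) = B v w) (s : Fin 3) :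
    ∑ a, B (orthoFrame g x a) (H.J s x (orthoFrame g x a)) = 0 := by
  obtain ⟨t, ht⟩ := H.exists_anticommute s
  exact sum_bilinForm_anticommuting_eq_zero (J := (H.J t x).toLinearMap)
    (K := (H.J s x).toLinearMap) (toMatrix_orthoFrame_inner g x)
    (LinearMap.ext₂ (hg t x)) (LinearMap.ext (ht x)) (LinearMap.ext₂ (hB t))

theorem IsHyperhermitian.sum_inner_complexStructure_eq_zero (hg : IsHyperhermitian H g)
    {A : Module.End ℝ (TangentSpace (𝓡 (4 * n)) x)} (hA : ∀ t v, A (H.J t x v) = H.J t x (A v))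
    (s : Fin 3) :
    ∑ a, g.inner x (A (orthoFrame g x a)) (H.J s x (orthoFrame g x a)) = 0 :=
  hg.sum_bilinForm_complexStructure_eq_zero (B := (g.inner x).toBilinForm.compLeft A)
    (fun t v _ => (congr(g.inner x $(hA t v) _)).trans (hg t x _ _)) s

end HyperhermitianTraces

section ObataCurvature

variable {n : ℕ} {M : Type*} [TopologicalSpace M] [T2Space M]
  [ChartedSpace (EuclideanSpace ℝ (Fin (4 * n))) M] [IsManifold (𝓡 (4 * n)) ∞ M]
  {H : HypercomplexStructure n M} {g : TangentMetric n M} {D : LinearConnection n M}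
  [D.ContMDiffCovariantDerivative ∞] {x : M}

theorem PreservesHypercomplex.curvatureEnd_apply (hD : PreservesHypercomplex H D) (s : Fin 3)
    (u v w : TangentSpace (𝓡 (4 * n)) x) :
    curvatureEnd D x u v (H.J s x w) = H.J s x (curvatureEnd D x u v w) :=
  IsParallelEndomorphism.curvatureEnd_apply (hD s) (H.smoothSectionNear s x) u v w

theorem curvatureFour_eq_inner_curvatureEnd (u v w z : TangentSpace (𝓡 (4 * n)) x) :
    curvatureFour g D x u v w z = g.inner x (curvatureEnd D x u v w) z := by
  have hcurvature : curvatureEnd D x u v w = curvature D x u v w := by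
    change curvatureField D _ _ _ x = curvature D x u v w
    simp only [curvatureField, curvature, FiberBundle.extend_apply_self]
  rw [hcurvature, curvatureFour]

theorem curvatureFour_bianchi (hT : ∀ x, D.torsion x = 0)
    (u v w z : TangentSpace (𝓡 (4 * n)) x) :
    curvatureFour g D x u v w z = curvatureFour g D x w v u z - curvatureFour g D x w u v z := by
  have h := congr(g.inner x $(curvatureEnd_bianchi hT u v w) z)
  rw [curvatureEnd_swap D v] at h
  simp only [map_add, map_neg, map_zero, add_apply, neg_apply, zero_apply] at h
  simp only [curvatureFour_eq_inner_curvatureEnd]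
  linarith

theorem ricciForm_eq_trace (u v : TangentSpace (𝓡 (4 * n)) x) :
    ricciForm g D x u v = LinearMap.trace ℝ _ (curvatureEnd D x u v) := by
  simp only [ricciForm, curvatureFour_eq_inner_curvatureEnd, sum_inner_orthoFrame_eq_trace]

theorem PreservesMetric.ricciForm_eq_zero (hg : PreservesMetric g D)
    (u v : TangentSpace (𝓡 (4 * n)) x) : ricciForm g D x u v = 0 :=
  Finset.sum_eq_zero fun a _ => by
    rw [curvatureFour_eq_inner_curvatureEnd]
    exact IsMetricConnection.inner_curvatureEnd_self hg u v (orthoFrame g x a)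

theorem PreservesHypercomplex.ricciFormJ_eq_zero (hD : PreservesHypercomplex H D)
    (hg : IsHyperhermitian H g) (s : Fin 3) (u v : TangentSpace (𝓡 (4 * n)) x) :
    ricciFormJ H g D s x u v = 0 := by
  simp only [ricciFormJ, curvatureFour_eq_inner_curvatureEnd]
  rw [hg.sum_inner_complexStructure_eq_zero (fun t => hD.curvatureEnd_apply t u v), mul_zero]

theorem ricciTensor_sub_swap (hT : ∀ x, D.torsion x = 0) (u v : TangentSpace (𝓡 (4 * n)) x) :
    ricciTensor g D x u v - ricciTensor g D x v u = -ricciForm g D x u v := by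
  simp only [ricciTensor, ricciForm, curvatureFour_bianchi hT u v, Finset.sum_sub_distrib, neg_sub]

theorem ricciTensor_complexStructure_add (hD : PreservesHypercomplex H D)
    (hT : ∀ x, D.torsion x = 0) (hg : IsHyperhermitian H g) (s : Fin 3)
    (u v : TangentSpace (𝓡 (4 * n)) x) :
    ricciTensor g D x (H.J s x u) (H.J s x v) + ricciTensor g D x v u
      = 2 * ricciFormJ H g D s x (H.J s x u) v := by
  have hleft : ∀ e, curvatureFour g D x e (H.J s x u) (H.J s x v) e
      = -curvatureFour g D x e (H.J s x u) v (H.J s x e) := fun e => by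
    simp only [curvatureFour_eq_inner_curvatureEnd, hD.curvatureEnd_apply, hg.inner_left]
  have hright : ∀ e, curvatureFour g D x e v (H.J s x u) (H.J s x e)
      = curvatureFour g D x e v u e := fun e => by
    simp only [curvatureFour_eq_inner_curvatureEnd, hD.curvatureEnd_apply, hg s x]
  simp only [ricciTensor, ricciFormJ, curvatureFour_bianchi hT (H.J s x u) v, hleft, hright,
    Finset.sum_sub_distrib, Finset.sum_neg_distrib]
  ring

end ObataCurvature

section ObataRicci

variable {n : ℕ} {M : Type*} [TopologicalSpace M] [T2Space M]
  [ChartedSpace (EuclideanSpace ℝ (Fin (4 * n))) M] [IsManifold (𝓡 (4 * n)) ∞ M]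
  {H : HypercomplexStructure n M} {g : TangentMetric n M} {D : LinearConnection n M} {x : M}

theorem IsObataConnection.ricciTensor_complexStructure_eq_neg_swap (hD : IsObataConnection H D)
    (hg : IsHyperhermitian H g) (s : Fin 3) (u v : TangentSpace (𝓡 (4 * n)) x) :
    ricciTensor g D x (H.J s x u) (H.J s x v) = -ricciTensor g D x v u := by
  have := hD.smooth
  rw [eq_neg_iff_add_eq_zero, ricciTensor_complexStructure_add hD.preserves hD.torsion_eq_zero hg,
    hD.preserves.ricciFormJ_eq_zero hg, mul_zero]

theorem IsObataConnection.ricciTensor_skew (hD : IsObataConnection H D)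
    (hg : IsHyperhermitian H g) (u v : TangentSpace (𝓡 (4 * n)) x) :
    ricciTensor g D x u v = -ricciTensor g D x v u := by
  have hJ := hD.ricciTensor_complexStructure_eq_neg_swap (x := x) hg
  calc ricciTensor g D x u v = -ricciTensor g D x (H.J 1 x v) (H.J 1 x u) := by rw [hJ, neg_neg]
    _ = ricciTensor g D x (H.J 0 x (H.J 1 x u)) (H.J 0 x (H.J 1 x v)) := (hJ 0 _ _).symm
    _ = ricciTensor g D x (H.J 2 x u) (H.J 2 x v) := by simp only [H.mul_01]
    _ = -ricciTensor g D x v u := hJ 2 u v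

theorem IsObataConnection.ricciTensor_complexStructure (hD : IsObataConnection H D)
    (hg : IsHyperhermitian H g) (s : Fin 3) (u v : TangentSpace (𝓡 (4 * n)) x) :
    ricciTensor g D x (H.J s x u) (H.J s x v) = ricciTensor g D x u v := by
  rw [hD.ricciTensor_complexStructure_eq_neg_swap hg, ← hD.ricciTensor_skew hg]

theorem IsObataConnection.ricciForm_eq_neg_two_mul_ricciTensor (hD : IsObataConnection H D)
    (hg : IsHyperhermitian H g) (u v : TangentSpace (𝓡 (4 * n)) x) :
    ricciForm g D x u v = -2 * ricciTensor g D x u v := by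
  have := hD.smooth
  have hsub := ricciTensor_sub_swap (g := g) hD.torsion_eq_zero u v
  have hskew := hD.ricciTensor_skew hg u v
  linarith

theorem IsObataConnection.scalarCurvature_eq_zero (hD : IsObataConnection H D)
    (hg : IsHyperhermitian H g) : scalarCurvature g D x = 0 :=
  Finset.sum_eq_zero fun _ _ => self_eq_neg.1 (hD.ricciTensor_skew hg _ _)

theorem ricciTensor_add_right [D.ContMDiffCovariantDerivative ∞]
    (u v w : TangentSpace (𝓡 (4 * n)) x) :
    ricciTensor g D x u (v + w) = ricciTensor g D x u v + ricciTensor g D x u w := by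
  simp [ricciTensor, curvatureFour_eq_inner_curvatureEnd, Finset.sum_add_distrib]

theorem ricciTensor_smul_right [D.ContMDiffCovariantDerivative ∞] (c : ℝ)
    (u v : TangentSpace (𝓡 (4 * n)) x) :
    ricciTensor g D x u (c • v) = c • ricciTensor g D x u v := by
  simp [ricciTensor, curvatureFour_eq_inner_curvatureEnd, Finset.mul_sum]

theorem IsObataConnection.exists_bilinForm_eq_ricciTensor (hD : IsObataConnection H D)
    (hg : IsHyperhermitian H g) :
    ∃ B : LinearMap.BilinForm ℝ (TangentSpace (𝓡 (4 * n)) x),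
      ∀ u v, B u v = ricciTensor g D x u v := by
  have := hD.smooth
  have hskew := hD.ricciTensor_skew (x := x) hg
  refine ⟨LinearMap.mk₂ ℝ (ricciTensor g D x) (fun u v w => ?_) (fun c u v => ?_)
    ricciTensor_add_right ricciTensor_smul_right, fun _ _ => rfl⟩
  · rw [hskew, ricciTensor_add_right, neg_add, ← hskew, ← hskew]
  · rw [hskew, ricciTensor_smul_right, ← smul_neg, ← hskew]

theorem IsObataConnection.scalarCurvatureJ_eq_zero (hD : IsObataConnection H D)
    (hg : IsHyperhermitian H g) (s : Fin 3) : scalarCurvatureJ H g D s x = 0 := by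
  obtain ⟨B, hB⟩ := hD.exists_bilinForm_eq_ricciTensor (x := x) hg
  have htrace := hg.sum_bilinForm_complexStructure_eq_zero (B := B)
    (fun t u v => by simp only [hB, hD.ricciTensor_complexStructure hg]) s
  simp only [hB] at htrace
  simp only [scalarCurvatureJ, hD.ricciTensor_skew hg (H.J s x _), Finset.sum_neg_distrib, htrace,
    neg_zero]

end ObataRicci

section LeeForm

variable {n : ℕ} {M : Type*} [TopologicalSpace M]
  [ChartedSpace (EuclideanSpace ℝ (Fin (4 * n))) M] [IsManifold (𝓡 (4 * n)) ∞ M]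
  {D D' : LinearConnection n M} {H : HypercomplexStructure n M} {g : TangentMetric n M} {x : M}

theorem PreservesHypercomplex.differenceEnd_apply (hD : PreservesHypercomplex H D)
    (hD' : PreservesHypercomplex H D') (s : Fin 3) (v w : TangentSpace (𝓡 (4 * n)) x) :
    differenceEnd D D' x v (H.J s x w) = H.J s x (differenceEnd D D' x v w) :=
  IsParallelEndomorphism.differenceEnd_apply (H.smoothSectionNear s x) (hD s) (hD' s) v w

theorem IsHKT.torsionThree_self (hD : IsHKT H g D) (v w : TangentSpace (𝓡 (4 * n)) x) :
    torsionThree g D x v w w = 0 :=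
  self_eq_neg.1 (hD.skew_torsion x v w w)

theorem IsHKT.torsionThree_complexStructure (hD : IsHKT H g D) (hD' : IsObataConnection H D')
    (t : Fin 3) (v e : TangentSpace (𝓡 (4 * n)) x) :
    torsionThree g D x (H.J t x v) e (H.J t x e)
      = g.inner x (differenceEnd D D' x v e) e
        - g.inner x (differenceEnd D D' x (H.J t x v) e) (H.J t x e) := by
  have htorsion := torsion_eq_differenceEnd_sub (D := D) hD'.torsion_eq_zero (x := x)
  have hself := hD.torsionThree_self v e
  rw [torsionThree, htorsion, map_sub, sub_apply, sub_eq_zero] at hself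
  rw [torsionThree, htorsion, map_sub, sub_apply,
    hD.preserves.differenceEnd_apply hD'.preserves, hD.hyperhermitian, hself]

theorem IsHKT.leeForm_eq_trace (hD : IsHKT H g D) (hD' : IsObataConnection H D') (t : Fin 3)
    (v : TangentSpace (𝓡 (4 * n)) x) :
    leeForm H g D t x v = -(1 / 2) * LinearMap.trace ℝ _ (differenceEnd D D' x v) := by
  simp only [leeForm, hD.torsionThree_complexStructure hD', Finset.sum_sub_distrib,
    sum_inner_orthoFrame_eq_trace, hD.hyperhermitian.sum_inner_complexStructure_eq_zero
      (hD.preserves.differenceEnd_apply hD'.preserves · _), sub_zero]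

theorem IsHKT.mvfderiv_leeForm [T2Space M] (hD : IsHKT H g D) (hD' : IsObataConnection H D')
    (t : Fin 3) {X : ∀ x : M, TangentSpace (𝓡 (4 * n)) x}
    (hX : SmoothSectionNear (𝓡 (4 * n)) (EuclideanSpace ℝ (Fin (4 * n))) X x)
    (w : TangentSpace (𝓡 (4 * n)) x) :
    mvfderiv (𝓡 (4 * n)) (fun y => leeForm H g D t y (X y)) x w
      = -(1 / 2) * mvfderiv (𝓡 (4 * n))
          (fun y => LinearMap.trace ℝ _ (differenceEnd D D' y (X y))) x w := by
  have := hD.smooth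
  have := hD'.smooth
  simp only [hD.leeForm_eq_trace hD']
  rw [mvfderiv_fun_mul mdifferentiableAt_const
    (smoothNear_trace_differenceEnd D D' hX).mdifferentiableAt, mvfderiv_const]
  simp

theorem IsHKT.ricciForm_eq_extDerivOneForm_leeForm [T2Space M] (hD : IsHKT H g D)
    (hD' : IsObataConnection H D') (t : Fin 3) (u v : TangentSpace (𝓡 (4 * n)) x) :
    ricciForm g D' x u v = -2 * extDerivOneForm (leeForm H g D t) x u v := by
  have := hD.smooth
  have := hD'.smooth
  have htrace := trace_curvatureEnd_sub D D' u v
  rw [← ricciForm_eq_trace (g := g), ← ricciForm_eq_trace (g := g),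
    hD.preserves_metric.ricciForm_eq_zero, sub_zero] at htrace
  rw [htrace, extDerivOneForm, hD.mvfderiv_leeForm hD' t (smoothSectionNear_extend u),
    hD.mvfderiv_leeForm hD' t (smoothSectionNear_extend v), hD.leeForm_eq_trace hD']
  ring

theorem IsHKT.ricciTensor_eq_extDerivOneForm_leeForm [T2Space M] (hD : IsHKT H g D)
    (hD' : IsObataConnection H D') (t : Fin 3) (u v : TangentSpace (𝓡 (4 * n)) x) :
    ricciTensor g D' x u v = extDerivOneForm (leeForm H g D t) x u v := by
  have hric := hD'.ricciForm_eq_neg_two_mul_ricciTensor hD.hyperhermitian u v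
  rw [hD.ricciForm_eq_extDerivOneForm_leeForm hD' t] at hric
  linarith

end LeeForm

theorem mainTheorem3 (n : ℕ) {M : Type*} [TopologicalSpace M] [T2Space M] [SigmaCompactSpace M]
    [ChartedSpace (EuclideanSpace ℝ (Fin (4 * n))) M] [IsManifold (𝓡 (4 * n)) ∞ M]
    (H : HypercomplexStructure n M) (Dob : LinearConnection n M) (hDob : IsObataConnection H Dob) :
    -- the identities on a hypercomplex manifold, with any auxiliary hyperhermitian metric `g`
    (∀ g : TangentMetric n M, IsHyperhermitian H g →
      ∀ (x : M) (X Y : TangentSpace (𝓡 (4 * n)) x),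
        (∀ s, ricciTensor g Dob x (H.J s x X) (H.J s x Y) + ricciTensor g Dob x Y X
          = 2 * ricciFormJ H g Dob s x (H.J s x X) Y) ∧
        ricciTensor g Dob x X Y - ricciTensor g Dob x Y X = -ricciForm g Dob x X Y) ∧
    -- the HKT case, with the Lee form computed from any of the three complex structures `J_t`
    (∀ (g : TangentMetric n M) (D : LinearConnection n M), IsHKT H g D → ∀ t : Fin 3,
      -- a) `dθ` is of type (1,1)
      (∀ s (x : M) (X Y : TangentSpace (𝓡 (4 * n)) x),
        extDerivOneForm (leeForm H g D t) x (H.J s x X) (H.J s x Y)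
          = extDerivOneForm (leeForm H g D t) x X Y) ∧
      -- b) the Ricci tensor and the Ricci-type forms of the Obata connection
      (∀ (x : M) (X Y : TangentSpace (𝓡 (4 * n)) x),
        ricciTensor g Dob x X Y = -ricciTensor g Dob x Y X ∧
        ricciTensor g Dob x X Y = extDerivOneForm (leeForm H g D t) x X Y ∧
        ricciForm g Dob x X Y = -2 * extDerivOneForm (leeForm H g D t) x X Y ∧
        (∀ s, ricciFormJ H g Dob s x X Y = 0) ∧
        (∀ s, ricciTensor g Dob x (H.J s x X) (H.J s x Y) = ricciTensor g Dob x X Y)) ∧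
      -- c) the scalar curvatures of the Obata connection vanish
      (∀ x : M, scalarCurvature g Dob x = 0 ∧ ∀ s, scalarCurvatureJ H g Dob s x = 0)) := by
  have := hDob.smooth
  refine ⟨fun g hg x X Y => ⟨fun s => ricciTensor_complexStructure_add hDob.preserves
    hDob.torsion_eq_zero hg s X Y, ricciTensor_sub_swap hDob.torsion_eq_zero X Y⟩,
    fun g D hD t => ?_⟩
  have hg := hD.hyperhermitian
  have hric (x : M) := hD.ricciTensor_eq_extDerivOneForm_leeForm (x := x) hDob t
  have hinv (s) (x : M) := hDob.ricciTensor_complexStructure (x := x) hg s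
  exact ⟨fun s x X Y => by rw [← hric, ← hric, hinv],
    fun x X Y => ⟨hDob.ricciTensor_skew hg X Y, hric x X Y,
      hD.ricciForm_eq_extDerivOneForm_leeForm hDob t X Y,
      fun s => hDob.preserves.ricciFormJ_eq_zero hg s X Y, fun s => hinv s x X Y⟩,
    fun _ => ⟨hDob.scalarCurvature_eq_zero hg, hDob.scalarCurvatureJ_eq_zero hg⟩⟩
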